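/- Let $p$ and $\ell$ be distinct primes. Let $\mathcal O$ be a complete discrete valuation ring whose residue field $k$ is algebraically closed of characteristic $p$ and whose field of fractions $K$ has characteristic $0$ and contains all $|G|$-th roots of unity, where $G$ is the following finite group. Let $$E=(\langle z\rangle\times\langle g\rangle)\rtimes\langle h\rangle\cong(C_\ell\times C_{\ell^2})\rtimes C_\ell,\qquad hz=zh,\quad hgh^{-1}=gz,$$ and $F=\langle z\rangle\times\langle g^\ell\rangle\times\langle h\rangle\le E$, $Z=\langle z\rangle$. Let $n$ be the multiplicative order of $p$ modulo $\ell^2$, let $\omega\in\mathbb F_{p^n}^\times$ be a primitive $\ell^2$-th root of unity, and let $D=D_1\times D_2$, where $D_1=D_2=\mathbb F_{p^n}$ as additive groups, so that $D\cong (C_p)^n\times (C_p)^n$. Put $G=D\rtimes E$, where $E$ acts on $D_1$ with kernel $\langle z\rangle\times\langle h\rangle$ and on $D_2$ with kernel $\langle z\rangle\times\langle g^\ell h\rangle$, and $g$ acts on both $D_1$ and $D_2$ as multiplication by $\omega$. Let $\varphi\in\mathrm{Irr}(Z)\setminus\{1_Z\}$, let $e_\varphi=|Z|^{-1}\sum_{x\in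 Z}\varphi(x^{-1})x$, and put $B=\mathcal OGe_\varphi$. Then $B$ is a block of $\mathcal OG$ with abelian defect group $D$ and abelian inertial quotient. Let $\lambda:G\to K^\times$ be a non-trivial linear character with $D\rtimes F$ in its kernel, that is, a non-trivial $\lambda\in\mathrm{Irr}(G|1_{D\rtimes F})$. Then tensoring with $\lambda$ is an endofunctor of the category of $B$-modules. It is induced by the $B$-$B$-bimodule $M_\lambda$ that is $B$ with the actions $ge_\varphi\cdot m=\lambda(g)gm$ and $m\cdot ge_\varphi=mg$ for $g\in G$, $m\in B$. This bimodule $M_\lambda$, viewed as an $\mathcal O(G\times G)$-module, is indecomposable with vertex $\Delta D=\{(x,x):x\in D\}$, and its isomorphism class is a non-trivial element of $\mathrm{Picent}(B)$. Here $\mathrm{Pic}(B)$ is the group, under $\otimes_B$, of isomorphism classes of $B$-$B$-bimodules that induce $\mathcal O$-linear Morita auto-equivalences of $B$, and $\mathrm{Picent}(B)$ is the subgroup of those that induce the trivial permutation of the set $\mathrm{Irr}(B)$ of irreducible characters of $G$ in $B$. -/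

import Mathlib

universe u

set_option linter.unusedSectionVars false

noncomputable section

open scoped TensorProduct

namespace PicardBlock

section Balanced

variable (O : Type u) [CommRing O] (A : Type u) [Ring A] [Algebra O A]

/-- The relations `(m · a) ⊗ v = m ⊗ (a · v)` in `M ⊗[O] V`, for an `A`-`A`-bimodule `M` (the right
action is the action of `Aᵐᵒᵖ`) and a left `A`-module `V`. -/
def balancedRel (M V : Type u) [AddCommGroup M] [Module O M] [Module A M] [Module Aᵐᵒᵖ M]
    [IsScalarTower O A M] [AddCommGroup V] [Module O V] [Module A V] :
    Submodule A (M ⊗[O] V) :=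
  Submodule.span A {x | ∃ (m : M) (a : A) (v : V),
    x = (MulOpposite.op a • m) ⊗ₜ[O] v - m ⊗ₜ[O] (a • v)}

/-- The tensor product `M ⊗_A V` of an `A`-`A`-bimodule `M` with a left `A`-module `V`, as a left
`A`-module. -/
def BTensor (M V : Type u) [AddCommGroup M] [Module O M] [Module A M] [Module Aᵐᵒᵖ M]
    [IsScalarTower O A M] [AddCommGroup V] [Module O V] [Module A V] : Type u :=
  (M ⊗[O] V) ⧸ balancedRel O A M V

end Balanced

namespace BTensor

section Left

variable {O : Type u} [CommRing O] {A : Type u} [Ring A] [Algebra O A]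
variable {M V W : Type u} [AddCommGroup M] [Module O M] [Module A M] [Module Aᵐᵒᵖ M]
  [IsScalarTower O A M] [AddCommGroup V] [Module O V] [Module A V]
  [AddCommGroup W] [Module O W]

instance : AddCommGroup (BTensor O A M V) :=
  inferInstanceAs (AddCommGroup ((M ⊗[O] V) ⧸ balancedRel O A M V))

instance : Module A (BTensor O A M V) :=
  inferInstanceAs (Module A ((M ⊗[O] V) ⧸ balancedRel O A M V))

instance : Module O (BTensor O A M V) :=
  inferInstanceAs (Module O ((M ⊗[O] V) ⧸ balancedRel O A M V))

instance : IsScalarTower O A (BTensor O A M V) :=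
  inferInstanceAs (IsScalarTower O A ((M ⊗[O] V) ⧸ balancedRel O A M V))

/-- The class of `m ⊗ v` in `M ⊗_A V`, as a bilinear map. -/
def mk : M →ₗ[O] V →ₗ[O] BTensor O A M V :=
  (TensorProduct.mk O M V).compr₂ ((balancedRel O A M V).mkQ.restrictScalars O)

theorem smul_mk (a : A) (m : M) (v : V) :
    a • (mk m v : BTensor O A M V) = mk (a • m) v := rfl

theorem mk_op_smul (m : M) (a : A) (v : V) :
    (mk (MulOpposite.op a • m) v : BTensor O A M V) = mk m (a • v) :=
  (Submodule.Quotient.eq (balancedRel O A M V)).2 (Submodule.subset_span ⟨m, a, v, rfl⟩)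

theorem induction {P : BTensor O A M V → Prop} (h0 : P 0)
    (h : ∀ m v, P (mk m v)) (hadd : ∀ x y, P x → P y → P (x + y)) (x) : P x := by
  obtain ⟨y, rfl⟩ := (balancedRel O A M V).mkQ_surjective x
  induction y with
  | zero => exact h0
  | tmul m v => exact h m v
  | add x y hx hy => exact hadd _ _ hx hy

theorem hom_ext {f g : BTensor O A M V →ₗ[O] W} (h : ∀ m v, f (mk m v) = g (mk m v)) : f = g := by
  refine LinearMap.ext fun x => ?_
  induction x using BTensor.induction with
  | h0 => simp
  | h m v => exact h m v
  | hadd x y hx hy => simp [hx, hy]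

variable [SMulCommClass A Aᵐᵒᵖ M]

/-- The additive subgroup spanned by the relations is already an `A`-submodule. -/
theorem lift_aux (f : M →ₗ[O] V →ₗ[O] W)
    (hf : ∀ m (a : A) v, f (MulOpposite.op a • m) v = f m (a • v)) :
    (balancedRel O A M V).restrictScalars O ≤ LinearMap.ker (TensorProduct.lift f) := by
  intro x hx
  suffices h : ∀ b : A, b • x ∈ LinearMap.ker (TensorProduct.lift f) by simpa using h 1
  replace hx : x ∈ balancedRel O A M V := hx
  induction hx using Submodule.span_induction with
  | mem x hx =>
    obtain ⟨m, a, v, rfl⟩ := hx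
    intro b
    simp [smul_sub, TensorProduct.smul_tmul', smul_comm b (MulOpposite.op a) m, hf]
  | zero => simp
  | add x y _ _ hx hy => intro b; rw [smul_add]; exact add_mem (hx b) (hy b)
  | smul a x _ hx => intro b; rw [smul_smul]; exact hx _

/-- The `O`-linear map out of `M ⊗_A V` defined by a balanced bilinear map. -/
def lift (f : M →ₗ[O] V →ₗ[O] W)
    (hf : ∀ m (a : A) v, f (MulOpposite.op a • m) v = f m (a • v)) : BTensor O A M V →ₗ[O] W :=
  ((balancedRel O A M V).restrictScalars O).liftQ (TensorProduct.lift f) (lift_aux f hf)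

theorem lift_mk (f : M →ₗ[O] V →ₗ[O] W)
    (hf : ∀ m (a : A) v, f (MulOpposite.op a • m) v = f m (a • v)) (m : M) (v : V) :
    lift f hf (mk m v) = f m v := rfl

end Left

/-- An `O`-linear equivalence that is `A`-linear. -/
def _root_.PicardBlock.upgrade {O A : Type u} [CommRing O] [Ring A] [Algebra O A]
    {X Y : Type u} [AddCommGroup X] [AddCommGroup Y]
    [Module O X] [Module O Y] [Module A X] [Module A Y]
    (e : X ≃ₗ[O] Y) (h : ∀ (a : A) x, e (a • x) = a • e x) : X ≃ₗ[A] Y :=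
  { e with map_smul' := h }

section Functor

variable {O : Type u} [CommRing O] {A : Type u} [Ring A] [Algebra O A]
variable {M M' V V' : Type u}
  [AddCommGroup M] [Module O M] [Module A M] [Module Aᵐᵒᵖ M]
  [IsScalarTower O A M] [SMulCommClass A Aᵐᵒᵖ M]
  [AddCommGroup M'] [Module O M'] [Module A M'] [Module Aᵐᵒᵖ M']
  [IsScalarTower O A M'] [SMulCommClass A Aᵐᵒᵖ M']
  [AddCommGroup V] [Module O V] [Module A V] [IsScalarTower O A V]
  [AddCommGroup V'] [Module O V'] [Module A V'] [IsScalarTower O A V']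

/-- Functoriality of `M ⊗_A V` in both variables. -/
def map (f : M →ₗ[A] M') (hf : ∀ (a : A) m, f (MulOpposite.op a • m) = MulOpposite.op a • f m)
    (g : V →ₗ[A] V') : BTensor O A M V →ₗ[O] BTensor O A M' V' :=
  lift ((mk (O := O) (A := A) (M := M') (V := V')).compl₁₂ (f.restrictScalars O)
    (g.restrictScalars O)) (fun m a v => by simp [hf, mk_op_smul])

theorem map_mk (f : M →ₗ[A] M')
    (hf : ∀ (a : A) m, f (MulOpposite.op a • m) = MulOpposite.op a • f m) (g : V →ₗ[A] V')
    (m : M) (v : V) : map (O := O) f hf g (mk m v) = mk (f m) (g v) := rfl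

/-- Isomorphic factors have isomorphic tensor products. -/
def congr (f : M ≃ₗ[A] M') (hf : ∀ (a : A) m, f (MulOpposite.op a • m) = MulOpposite.op a • f m)
    (g : V ≃ₗ[A] V') : BTensor O A M V ≃ₗ[A] BTensor O A M' V' :=
  upgrade (O := O) (LinearEquiv.ofLinearMap (map f.toLinearMap hf g.toLinearMap)
    (map f.symm.toLinearMap (fun a m => f.injective (by simp [hf])) g.symm.toLinearMap)
    (hom_ext fun m v => by simp [map_mk]) (hom_ext fun m v => by simp [map_mk]))
    (fun a x => by
      induction x using BTensor.induction with
      | h0 => simp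
      | h m v => simp [smul_mk, map_mk]
      | hadd x y hx hy => simp_all)

theorem congr_mk (f : M ≃ₗ[A] M')
    (hf : ∀ (a : A) m, f (MulOpposite.op a • m) = MulOpposite.op a • f m) (g : V ≃ₗ[A] V')
    (m : M) (v : V) : congr (O := O) f hf g (mk m v) = mk (f m) (g v) := rfl

/-- The multiplication map `A ⊗_A V → V`. -/
def lidMap : BTensor O A A V →ₗ[O] V :=
  lift (LinearMap.mk₂ O (fun (a : A) (v : V) => a • v) add_smul (fun _ _ _ => smul_assoc _ _ _)
    smul_add (fun _ _ _ => smul_algebra_smul_comm _ _ _)) (fun m a v => by simp [mul_smul])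

theorem lidMap_mk (a : A) (v : V) : lidMap (O := O) (mk a v : BTensor O A A V) = a • v := rfl

/-- `A ⊗_A V ≅ V`. -/
def lid : BTensor O A A V ≃ₗ[A] V :=
  upgrade (O := O) (LinearEquiv.ofLinearMap lidMap
    ((mk : A →ₗ[O] V →ₗ[O] BTensor O A A V) 1)
    (LinearMap.ext fun v => one_smul A v)
    (hom_ext fun a v => by
      have h := mk_op_smul (O := O) (M := A) (1 : A) a v
      rw [MulOpposite.smul_eq_mul_unop, MulOpposite.unop_op, one_mul] at h
      exact h.symm))
    (fun a x => by
      induction x using BTensor.induction with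
      | h0 => simp
      | h m v => exact mul_smul a m v
      | hadd x y hx hy => simp_all)

theorem lid_mk (a : A) (v : V) : lid (O := O) (mk a v) = a • v := rfl

end Functor

section Right

variable {O : Type u} [CommRing O] {A : Type u} [Ring A] [Algebra O A]
variable {M N V : Type u}
  [AddCommGroup M] [Module O M] [Module A M] [Module Aᵐᵒᵖ M]
  [IsScalarTower O A M] [IsScalarTower O Aᵐᵒᵖ M] [SMulCommClass A Aᵐᵒᵖ M]
  [AddCommGroup N] [Module O N] [Module A N] [Module Aᵐᵒᵖ N]
  [IsScalarTower O A N] [IsScalarTower O Aᵐᵒᵖ N] [SMulCommClass A Aᵐᵒᵖ N]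
  [AddCommGroup V] [Module O V] [Module A V] [IsScalarTower O A V]

/-- Right multiplication by `b` on the second factor of `M ⊗_A N`. -/
def rmul (b : Aᵐᵒᵖ) : BTensor O A M N →ₗ[O] BTensor O A M N :=
  lift (LinearMap.mk₂ O (fun m n => mk m (b • n)) (by simp) (by simp) (by simp)
    (fun c m n => by rw [smul_comm b c n]; simp))
    (fun m a v => by simp [mk_op_smul, smul_comm])

theorem rmul_mk (b : Aᵐᵒᵖ) (m : M) (n : N) :
    rmul b (mk m n : BTensor O A M N) = mk m (b • n) := rfl

/-- The right `A`-action on `M ⊗_A N`: `(m ⊗ n) · b = m ⊗ (n · b)`. -/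
instance : Module Aᵐᵒᵖ (BTensor O A M N) where
  smul b x := rmul b x
  one_smul x := by
    change rmul 1 x = x
    induction x using BTensor.induction with
    | h0 => simp
    | h m v => simp [rmul_mk]
    | hadd x y hx hy => simp [hx, hy]
  mul_smul b c x := by
    change rmul (b * c) x = rmul b (rmul c x)
    induction x using BTensor.induction with
    | h0 => simp
    | h m v => simp [rmul_mk, mul_smul]
    | hadd x y hx hy => simp [hx, hy]
  smul_zero b := (rmul b).map_zero
  smul_add b := (rmul b).map_add
  add_smul b c x := by
    change rmul (b + c) x = rmul b x + rmul c x
    induction x using BTensor.induction with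
    | h0 => simp
    | h m v => simp [rmul_mk, add_smul]
    | hadd x y hx hy => rw [map_add, map_add, map_add, hx, hy]; abel
  zero_smul x := by
    change rmul 0 x = 0
    induction x using BTensor.induction with
    | h0 => simp
    | h m v => simp [rmul_mk]
    | hadd x y hx hy => simp [hx, hy]

theorem op_smul_mk (b : Aᵐᵒᵖ) (m : M) (n : N) :
    b • (mk m n : BTensor O A M N) = mk m (b • n) := rfl

instance : SMulCommClass A Aᵐᵒᵖ (BTensor O A M N) where
  smul_comm a b x := by
    induction x using BTensor.induction with
    | h0 => simp
    | h m v => simp [smul_mk, op_smul_mk]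
    | hadd x y hx hy => simp [hx, hy]

instance : IsScalarTower O Aᵐᵒᵖ (BTensor O A M N) where
  smul_assoc c b x := by
    induction x using BTensor.induction with
    | h0 => simp
    | h m v => simp [op_smul_mk]
    | hadd x y hx hy => simp [hx, hy]

/-- `(M ⊗_A N) ⊗_A V ≅ M ⊗_A (N ⊗_A V)`. -/
def assoc : BTensor O A (BTensor O A M N) V ≃ₗ[A] BTensor O A M (BTensor O A N V) :=
  upgrade (O := O) (LinearEquiv.ofLinearMap
    (lift (lift (LinearMap.mk₂ O
        (fun (m : M) (n : N) => (mk m : _ →ₗ[O] BTensor O A M (BTensor O A N V)) ∘ₗ mk n)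
        (by intros; ext; simp) (by intros; ext; simp) (by intros; ext; simp)
        (by intros; ext; simp))
        (fun m a n => by ext v; simp [mk_op_smul, smul_mk]))
      (fun x a v => by
        induction x using BTensor.induction with
        | h0 => simp
        | h m n => simp [op_smul_mk, lift_mk, mk_op_smul]
        | hadd x y hx hy => simp [hx, hy]))
    (lift (LinearMap.mk₂ O
        (fun (m : M) (y : BTensor O A N V) =>
          lift (((mk : _ →ₗ[O] V →ₗ[O] BTensor O A (BTensor O A M N) V)) ∘ₗ mk m)
            (fun n a v => by simp [← op_smul_mk, mk_op_smul]) y)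
        (fun m m' y => by
          induction y using BTensor.induction with
          | h0 => simp
          | h n v => simp [lift_mk]
          | hadd x y hx hy =>
            rw [map_add (lift _ _), hx, hy, map_add (lift _ _), map_add (lift _ _)]; abel)
        (fun c m y => by
          induction y using BTensor.induction with
          | h0 => simp
          | h n v => simp [lift_mk]
          | hadd x y hx hy => simp only [map_add, hx, hy, smul_add])
        (by simp) (by simp))
      (fun m a y => by
        induction y using BTensor.induction with
        | h0 => simp
        | h n v => simp [lift_mk, smul_mk, mk_op_smul]
        | hadd x y hx hy => simp only [map_add, hx, hy, smul_add]))
    (hom_ext fun m y => by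
      induction y using BTensor.induction with
      | h0 => simp
      | h n v => simp [lift_mk]
      | hadd x y hx hy => simp only [map_add, hx, hy])
    (hom_ext fun x v => by
      induction x using BTensor.induction with
      | h0 => simp
      | h m n => simp [lift_mk]
      | hadd x y hx hy => simp only [map_add, LinearMap.add_apply, hx, hy]))
    (fun a x => by
      induction x using BTensor.induction with
      | h0 => simp
      | h x v =>
        induction x using BTensor.induction with
        | h0 => simp
        | h m n => simp [smul_mk, lift_mk]
        | hadd x y hx hy => simp only [map_add, LinearMap.add_apply, smul_add, hx, hy]
      | hadd x y hx hy => simp only [map_add, smul_add, hx, hy])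

theorem assoc_mk (m : M) (n : N) (v : V) :
    assoc (O := O) (A := A) (mk (mk m n) v) = mk m (mk n v) := rfl

/-- The multiplication map `M ⊗_A A → M`. -/
def ridMap : BTensor O A M A →ₗ[O] M :=
  lift (LinearMap.mk₂ O (fun (m : M) (a : A) => MulOpposite.op a • m)
    (by simp) (fun c m a => smul_comm _ _ _) (by simp [add_smul])
    (fun c m a => by rw [MulOpposite.op_smul, smul_assoc])) (fun m a b => by
      simp [← mul_smul])

/-- `M ⊗_A A ≅ M`. -/
def rid : BTensor O A M A ≃ₗ[A] M :=
  upgrade (O := O) (LinearEquiv.ofLinearMap ridMap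
    ((mk : M →ₗ[O] A →ₗ[O] BTensor O A M A).flip 1)
    (LinearMap.ext fun m => one_smul Aᵐᵒᵖ m)
    (hom_ext fun m a => by
      have h := mk_op_smul (O := O) (V := A) m a (1 : A)
      rw [smul_eq_mul, mul_one] at h
      exact h))
    (fun a x => by
      induction x using BTensor.induction with
      | h0 => simp
      | h m b => exact (smul_comm a (MulOpposite.op b) m).symm
      | hadd x y hx hy => simp_all)

theorem rid_mk (m : M) (a : A) : rid (O := O) (mk m a) = MulOpposite.op a • m := rfl

theorem congr_op_smul {M' N' : Type u}
    [AddCommGroup M'] [Module O M'] [Module A M'] [Module Aᵐᵒᵖ M']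
    [IsScalarTower O A M'] [IsScalarTower O Aᵐᵒᵖ M'] [SMulCommClass A Aᵐᵒᵖ M']
    [AddCommGroup N'] [Module O N'] [Module A N'] [Module Aᵐᵒᵖ N']
    [IsScalarTower O A N'] [IsScalarTower O Aᵐᵒᵖ N'] [SMulCommClass A Aᵐᵒᵖ N']
    (f : M ≃ₗ[A] M') (hf : ∀ (a : A) m, f (MulOpposite.op a • m) = MulOpposite.op a • f m)
    (g : N ≃ₗ[A] N') (hg : ∀ (a : A) n, g (MulOpposite.op a • n) = MulOpposite.op a • g n)
    (a : A) (x : BTensor O A M N) :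
    congr f hf g (MulOpposite.op a • x) = MulOpposite.op a • congr f hf g x := by
  induction x using BTensor.induction with
  | h0 => simp
  | h m n => simp [op_smul_mk, congr_mk, hg]
  | hadd x y hx hy => simp only [map_add, smul_add, hx, hy]

theorem assoc_op_smul {P : Type u} [AddCommGroup P] [Module O P] [Module A P] [Module Aᵐᵒᵖ P]
    [IsScalarTower O A P] [IsScalarTower O Aᵐᵒᵖ P] [SMulCommClass A Aᵐᵒᵖ P]
    (a : A) (x : BTensor O A (BTensor O A M N) P) :
    assoc (MulOpposite.op a • x) = MulOpposite.op a • assoc x := by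
  induction x using BTensor.induction with
  | h0 => simp
  | h y p =>
    induction y using BTensor.induction with
    | h0 => simp
    | h m n => rfl
    | hadd x y hx hy => simp only [map_add, LinearMap.add_apply, smul_add, hx, hy]
  | hadd x y hx hy => simp only [map_add, smul_add, hx, hy]

theorem lid_op_smul (a : A) (x : BTensor O A A M) :
    lid (MulOpposite.op a • x) = MulOpposite.op a • lid x := by
  induction x using BTensor.induction with
  | h0 => simp
  | h b m => exact smul_comm b (MulOpposite.op a) m
  | hadd x y hx hy => simp only [map_add, smul_add, hx, hy]

theorem rid_op_smul (a : A) (x : BTensor O A M A) :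
    rid (MulOpposite.op a • x) = MulOpposite.op a • rid x := by
  induction x using BTensor.induction with
  | h0 => simp
  | h m b => exact mul_smul (MulOpposite.op a) (MulOpposite.op b) m
  | hadd x y hx hy => simp only [map_add, smul_add, hx, hy]

end Right

end BTensor
section Picard

/-- An `A`-`A`-bimodule over `O`: commuting left and right `A`-actions on which `O` acts centrally.
The right action is given as a left action of `Aᵐᵒᵖ`. -/
structure BimoduleOver (O : Type u) [CommRing O] (A : Type u) [Ring A] [Algebra O A] where
  carrier : Type u
  [addCommGroup : AddCommGroup carrier]
  [moduleBase : Module O carrier]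
  [moduleLeft : Module A carrier]
  [moduleRight : Module Aᵐᵒᵖ carrier]
  [towerLeft : IsScalarTower O A carrier]
  [towerRight : IsScalarTower O Aᵐᵒᵖ carrier]
  [smulComm : SMulCommClass A Aᵐᵒᵖ carrier]

attribute [instance] BimoduleOver.addCommGroup BimoduleOver.moduleBase BimoduleOver.moduleLeft BimoduleOver.moduleRight
  BimoduleOver.towerLeft BimoduleOver.towerRight BimoduleOver.smulComm

variable {O : Type u} [CommRing O] {A : Type u} [Ring A] [Algebra O A]

namespace BimoduleOver

/-- `M` and `N` are isomorphic as bimodules. -/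
def IsIso (M N : BimoduleOver O A) : Prop :=
  ∃ f : M.carrier ≃ₗ[A] N.carrier,
    ∀ (a : A) (m : M.carrier), f (MulOpposite.op a • m) = MulOpposite.op a • f m

variable (O A) in
/-- The regular bimodule `A`. -/
abbrev regular : BimoduleOver O A where
  carrier := A

/-- The bimodule `M ⊗_A N`. -/
abbrev tensor (M N : BimoduleOver O A) : BimoduleOver O A where
  carrier := BTensor O A M.carrier N.carrier

theorem IsIso.refl (M : BimoduleOver O A) : M.IsIso M := ⟨LinearEquiv.refl A _, fun _ _ => rfl⟩

theorem IsIso.symm {M N : BimoduleOver O A} : M.IsIso N → N.IsIso M := fun ⟨f, hf⟩ =>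
  ⟨f.symm, fun a m => f.injective (by simp [hf])⟩

theorem IsIso.trans {M N P : BimoduleOver O A} : M.IsIso N → N.IsIso P → M.IsIso P :=
  fun ⟨f, hf⟩ ⟨g, hg⟩ => ⟨f.trans g, fun a m => by simp [hf, hg]⟩

theorem tensor_congr {M M' N N' : BimoduleOver O A} : M.IsIso M' → N.IsIso N' →
    (M.tensor N).IsIso (M'.tensor N') := fun ⟨f, hf⟩ ⟨g, hg⟩ =>
  ⟨BTensor.congr f hf g, BTensor.congr_op_smul f hf g hg⟩

theorem tensor_assoc (M N P : BimoduleOver O A) :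
    ((M.tensor N).tensor P).IsIso (M.tensor (N.tensor P)) :=
  ⟨BTensor.assoc, BTensor.assoc_op_smul⟩

theorem regular_tensor (M : BimoduleOver O A) : ((regular O A).tensor M).IsIso M :=
  ⟨BTensor.lid, BTensor.lid_op_smul⟩

theorem tensor_regular (M : BimoduleOver O A) : (M.tensor (regular O A)).IsIso M :=
  ⟨BTensor.rid, BTensor.rid_op_smul⟩

variable (O A) in
/-- Isomorphism of bimodules, as an equivalence relation. -/
def isoSetoid : Setoid (BimoduleOver O A) where
  r := IsIso
  iseqv := ⟨IsIso.refl, IsIso.symm, IsIso.trans⟩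

end BimoduleOver

variable (O A) in
/-- The isomorphism classes of `A`-`A`-bimodules over `O`. -/
def BimoduleClass : Type (u + 1) := Quotient (BimoduleOver.isoSetoid O A)

/-- The isomorphism class of a bimodule. -/
def BimoduleOver.cls (M : BimoduleOver O A) : BimoduleClass O A := Quotient.mk (BimoduleOver.isoSetoid O A) M

/-- The multiplication on isomorphism classes is `⊗_A`, its identity is the class of `A`. -/
instance : Monoid (BimoduleClass O A) where
  mul := Quotient.map₂ BimoduleOver.tensor fun _ _ h _ _ h' => BimoduleOver.tensor_congr h h'
  one := (BimoduleOver.regular O A).cls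
  mul_assoc := by
    rintro ⟨M⟩ ⟨N⟩ ⟨P⟩
    exact Quotient.sound (BimoduleOver.tensor_assoc M N P)
  one_mul := by
    rintro ⟨M⟩
    exact Quotient.sound (BimoduleOver.regular_tensor M)
  mul_one := by
    rintro ⟨M⟩
    exact Quotient.sound (BimoduleOver.tensor_regular M)

variable (O A) in
/-- The Picard group of `A`: isomorphism classes of bimodules `M` that induce an `O`-linear Morita
auto-equivalence `M ⊗_A -` of `A`, that is, for which there is a bimodule `N` such that
`M ⊗_A N ≅ A ≅ N ⊗_A M` as bimodules. The multiplication is `⊗_A`. -/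
abbrev Pic : Type (u + 1) := (BimoduleClass O A)ˣ

/-- A module `V` over `K ⊗_O A`, given by commuting actions of `K` and `A`, is simple: it is
nonzero and its only `A`-stable `K`-subspaces are `0` and `V`. -/
def IsSimpleOver (K A V : Type u) [Field K] [Ring A] [AddCommGroup V] [Module K V] [Module A V] :
    Prop :=
  Nontrivial V ∧ ∀ W : Submodule K V, (∀ (a : A), ∀ w ∈ W, a • w ∈ W) → W = ⊥ ∨ W = ⊤

/-- The functor `M ⊗_A -` maps every simple `K ⊗_O A`-module `V` to an isomorphic module, where `K`
is the field of fractions of `O`. As `K` acts through `V` on `M ⊗_A V`, this module is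
`(K ⊗_O M) ⊗_{K ⊗_O A} V`, and an `A`-linear isomorphism is automatically `K`-linear.
When `K ⊗_O A` is a block of a finite group over a splitting field `K` of characteristic zero, the
isomorphism classes of the modules `V` are the irreducible characters in the block, so that this
means that `M` induces the trivial permutation of the irreducible characters. -/
def BimoduleOver.FixesIrr (K : Type u) [Field K] [Algebra O K] (M : BimoduleOver O A) : Prop :=
  ∀ (V : Type u) [AddCommGroup V] [Module O V] [Module A V] [Module K V]
    [IsScalarTower O A V] [IsScalarTower O K V] [SMulCommClass K A V],
    IsSimpleOver K A V → Nonempty (BTensor O A M.carrier V ≃ₗ[A] V)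

theorem BimoduleOver.fixesIrr_of_isIso (K : Type u) [Field K] [Algebra O K] {M N : BimoduleOver O A}
    (h : M.IsIso N) (hM : M.FixesIrr K) : N.FixesIrr K := by
  intro V _ _ _ _ _ _ _ hV
  obtain ⟨f, hf⟩ := h.symm
  obtain ⟨g⟩ := hM V hV
  exact ⟨(BTensor.congr f hf (LinearEquiv.refl A V)).trans g⟩

theorem BimoduleOver.fixesIrr_regular (K : Type u) [Field K] [Algebra O K] :
    (BimoduleOver.regular O A).FixesIrr K := by
  intro V _ _ _ _ _ _ _ _
  exact ⟨BTensor.lid⟩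

theorem BimoduleOver.fixesIrr_tensor (K : Type u) [Field K] [Algebra O K] {M N : BimoduleOver O A}
    (hM : M.FixesIrr K) (hN : N.FixesIrr K) : (M.tensor N).FixesIrr K := by
  intro V _ _ _ _ _ _ _ hV
  obtain ⟨f⟩ := hM V hV
  obtain ⟨g⟩ := hN V hV
  exact ⟨BTensor.assoc.trans ((BTensor.congr (LinearEquiv.refl A M.carrier) (fun _ _ => rfl) g).trans
    f)⟩

theorem BimoduleOver.fixesIrr_of_tensor (K : Type u) [Field K] [Algebra O K] {M N : BimoduleOver O A}
    (h : (N.tensor M).IsIso (BimoduleOver.regular O A)) (hM : M.FixesIrr K) : N.FixesIrr K := by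
  intro V _ _ _ _ _ _ _ hV
  obtain ⟨f⟩ := BimoduleOver.fixesIrr_of_isIso K h.symm (BimoduleOver.fixesIrr_regular K) V hV
  obtain ⟨g⟩ := hM V hV
  exact ⟨(BTensor.congr (LinearEquiv.refl A N.carrier) (fun _ _ => rfl) g.symm).trans
    (BTensor.assoc.symm.trans f)⟩

variable (O A) in
/-- `Picent`: the subgroup of the Picard group of those Morita auto-equivalences that induce the
trivial permutation of the irreducible characters. -/
def Picent (K : Type u) [Field K] [Algebra O K] : Subgroup (Pic O A) where
  carrier := {x | ∃ M : BimoduleOver O A, M.cls = x ∧ M.FixesIrr K}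
  one_mem' := ⟨BimoduleOver.regular O A, rfl, BimoduleOver.fixesIrr_regular K⟩
  mul_mem' := by
    rintro x y ⟨M, hM, hM'⟩ ⟨N, hN, hN'⟩
    refine ⟨M.tensor N, ?_, BimoduleOver.fixesIrr_tensor K hM' hN'⟩
    rw [Units.val_mul, ← hM, ← hN]
    rfl
  inv_mem' := by
    rintro x ⟨M, hM, hM'⟩
    obtain ⟨N, hN⟩ := Quotient.exists_rep (x⁻¹ : Pic O A).val
    refine ⟨N, hN, BimoduleOver.fixesIrr_of_tensor K ?_ hM'⟩
    have h : N.cls * M.cls = 1 := by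
      rw [hM, show N.cls = (x⁻¹ : Pic O A).val from hN, Units.inv_mul]
    exact Quotient.exact h

end Picard

end PicardBlock

namespace PicardBlock

section Twist

variable {O : Type u} [CommRing O] {A : Type u} [Ring A] [Algebra O A]

/-- `V` with `a : A` acting as `α a`. -/
def Twisted (_ : A →ₐ[O] A) (V : Type u) : Type u := V

/-- The identity map from `V` to its twist. -/
def toTwisted (α : A →ₐ[O] A) (V : Type u) : V ≃ Twisted α V := Equiv.refl V

section

variable (α : A →ₐ[O] A) (V : Type u) [AddCommGroup V] [Module O V] [Module A V]

instance : AddCommGroup (Twisted α V) := inferInstanceAs (AddCommGroup V)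

instance : Module O (Twisted α V) := inferInstanceAs (Module O V)

instance : Module A (Twisted α V) := Module.compHom V α.toRingHom

theorem twisted_smul (a : A) (v : V) : a • toTwisted α V v = toTwisted α V (α a • v) := rfl

instance [IsScalarTower O A V] : IsScalarTower O A (Twisted α V) where
  smul_assoc c a v := by
    change α (c • a) • (show V from v) = c • (α a • (show V from v))
    rw [map_smul, smul_assoc]

instance [Module Aᵐᵒᵖ V] : Module Aᵐᵒᵖ (Twisted α V) := inferInstanceAs (Module Aᵐᵒᵖ V)

instance [Module Aᵐᵒᵖ V] [IsScalarTower O Aᵐᵒᵖ V] : IsScalarTower O Aᵐᵒᵖ (Twisted α V) :=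
  inferInstanceAs (IsScalarTower O Aᵐᵒᵖ V)

instance [Module Aᵐᵒᵖ V] [SMulCommClass A Aᵐᵒᵖ V] : SMulCommClass A Aᵐᵒᵖ (Twisted α V) where
  smul_comm a b v := smul_comm (α a) b (show V from v)

end

/-- The bimodule `A` with the left action twisted by `α`: `x · m · y = α(x) m y`. -/
abbrev BimoduleOver.twist (α : A →ₐ[O] A) : BimoduleOver O A where
  carrier := Twisted α A

/-- The functor `M ⊗_A -` on left `A`-modules is naturally isomorphic to the functor that twists the
action of `A` by `α`. -/
def BimoduleOver.InducesTwist (M : BimoduleOver O A) (α : A →ₐ[O] A) : Prop :=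
  ∃ f : ∀ (V : Type u) [AddCommGroup V] [Module O V] [Module A V] [IsScalarTower O A V],
      BTensor O A M.carrier V ≃ₗ[A] Twisted α V,
    ∀ (V W : Type u) [AddCommGroup V] [Module O V] [Module A V] [IsScalarTower O A V]
      [AddCommGroup W] [Module O W] [Module A W] [IsScalarTower O A W]
      (g : V →ₗ[A] W) (m : M.carrier) (v : V),
      f W (BTensor.mk m (g v)) =
        toTwisted α W (g ((toTwisted α V).symm (f V (BTensor.mk m v))))

end Twist

section Corner

variable {O : Type u} [CommRing O] {R : Type u} [Ring R] [Algebra O R] {e : R}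

/-- The ring `e R e` with identity `e` is an `O`-algebra. -/
instance cornerModule (he : IsIdempotentElem e) : Module O he.Corner where
  smul c x := ⟨c • x.1, by
    obtain ⟨r, hr⟩ := x.2
    exact ⟨c • r, by rw [← hr]; simp⟩⟩
  one_smul x := Subtype.ext (one_smul O x.1)
  mul_smul c d x := Subtype.ext (mul_smul c d x.1)
  smul_zero c := Subtype.ext (smul_zero c)
  smul_add c x y := Subtype.ext (smul_add c x.1 y.1)
  add_smul c d x := Subtype.ext (add_smul c d x.1)
  zero_smul x := Subtype.ext (zero_smul O x.1)

instance cornerAlgebra (he : IsIdempotentElem e) : Algebra O he.Corner :=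
  Algebra.ofModule (fun c x y => Subtype.ext (smul_mul_assoc c x.1 y.1))
    (fun c x y => Subtype.ext (mul_smul_comm c x.1 y.1))

/-- An endomorphism of `R` that fixes `e` restricts to `e R e`. -/
def cornerMap (he : IsIdempotentElem e) (f : R →ₐ[O] R) (hf : f e = e) :
    he.Corner →ₐ[O] he.Corner :=
  AlgHom.ofLinearMap
    { toFun := fun x => ⟨f x.1, by
        obtain ⟨r, hr⟩ := x.2
        exact ⟨f r, by rw [← hr]; simp [hf]⟩⟩
      map_add' := fun x y => Subtype.ext (map_add f x.1 y.1)
      map_smul' := fun c x => Subtype.ext (map_smul f c x.1) }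
    (Subtype.ext hf) (fun x y => Subtype.ext (map_mul f x.1 y.1))

end Corner

section Blocks

open MonoidAlgebra (single)

/-- `e` is a block idempotent of the group algebra `R G`: a primitive idempotent of its centre. -/
structure IsBlockIdempotent {R G : Type*} [CommRing R] [Group G] (e : MonoidAlgebra R G) :
    Prop where
  idem : IsIdempotentElem e
  central : ∀ x, e * x = x * e
  ne_zero : e ≠ 0
  primitive : ∀ f : MonoidAlgebra R G, IsIdempotentElem f → (∀ x, f * x = x * f) → f * e = f →
    f = 0 ∨ f = e

/-- `e` is the relative trace `∑ x a x⁻¹`, over `x` in `G / P`, of some `a` in `(R G)^P`. -/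
def IsRelTrace {R G : Type*} [CommRing R] [Group G] (P : Subgroup G) (e : MonoidAlgebra R G) :
    Prop :=
  ∃ a : MonoidAlgebra R G, (∀ u ∈ P, single u 1 * a = a * single u 1) ∧
    ∑ᶠ q : G ⧸ P, single q.out 1 * a * single q.out⁻¹ 1 = e

/-- `P` is a defect group of the block with block idempotent `e`: a minimal subgroup such that `e`
is a relative trace from `P`. -/
def IsDefectGroup {R G : Type*} [CommRing R] [Group G] (e : MonoidAlgebra R G) (P : Subgroup G) :
    Prop :=
  IsRelTrace P e ∧ ∀ Q ≤ P, IsRelTrace Q e → Q = P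

/-- The Brauer map at `P`: reduce the coefficients modulo the maximal ideal and restrict to the
centralizer of `P`. -/
def brauerMap {O G : Type*} [CommRing O] [IsLocalRing O] [Group G] (P : Subgroup G)
    (a : MonoidAlgebra O G) :
    MonoidAlgebra (IsLocalRing.ResidueField O) (Subgroup.centralizer (P : Set G)) :=
  ∑ᶠ c : Subgroup.centralizer (P : Set G), single c (IsLocalRing.residue O (a.coeff (c : G)))

/-- The block idempotent `f` of `k C_G(P)` is such that `(P, f)` is a Brauer pair of the block with
block idempotent `e`. -/
def IsBrauerPair {O G : Type*} [CommRing O] [IsLocalRing O] [Group G] (e : MonoidAlgebra O G)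
    (P : Subgroup G)
    (f : MonoidAlgebra (IsLocalRing.ResidueField O) (Subgroup.centralizer (P : Set G))) : Prop :=
  IsBlockIdempotent f ∧ brauerMap P e * f = f

/-- The elements of `N_G(P, f)`, the stabilizer of the pair `(P, f)` in `G`. -/
def pairStabilizer {k G : Type*} [CommRing k] [Group G] (P : Subgroup G)
    (f : MonoidAlgebra k (Subgroup.centralizer (P : Set G))) : Set G :=
  {x | x ∈ Subgroup.normalizer (P : Set G) ∧
    single x 1 * f.mapDomain (Subgroup.centralizer (P : Set G)).subtype =
      f.mapDomain (Subgroup.centralizer (P : Set G)).subtype * single x 1}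

/-- The inertial quotient `N_G(P, f) / P C_G(P)` of the block with block idempotent `e` is abelian,
where `P` is a defect group and `(P, f)` is a (necessarily maximal) Brauer pair of the block. The
pair is unique up to conjugation. -/
def HasAbelianInertialQuotient {O G : Type*} [CommRing O] [IsLocalRing O] [Group G]
    (e : MonoidAlgebra O G) (P : Subgroup G) : Prop :=
  ∃ f, IsBrauerPair e P f ∧ ∀ x ∈ pairStabilizer P f, ∀ y ∈ pairStabilizer P f,
    x * y * x⁻¹ * y⁻¹ ∈ P ⊔ Subgroup.centralizer (P : Set G)

/-- The representation `M` of `H` is relatively `Q`-projective: it is a direct summand of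
`Ind_Q^H Res_Q^H M`. -/
def IsRelProjective {O H M : Type*} [CommRing O] [Group H] [AddCommGroup M] [Module O M]
    (ρ : Representation O H M) (Q : Subgroup H) : Prop :=
  ∃ (i : ρ.IntertwiningMap (Representation.ind Q.subtype (ρ.comp Q.subtype)))
    (π : (Representation.ind Q.subtype (ρ.comp Q.subtype)).IntertwiningMap ρ),
    ∀ m, π (i m) = m

/-- `M` is an indecomposable representation with vertex `Q`: a minimal subgroup such that `M` is
relatively `Q`-projective. -/
structure HasVertex {O H M : Type*} [CommRing O] [Group H] [AddCommGroup M] [Module O M]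
    (ρ : Representation O H M) (Q : Subgroup H) : Prop where
  nontrivial : Nontrivial M
  indecomposable : ∀ f : ρ.IntertwiningMap ρ, (∀ m, f (f m) = f m) →
    (∀ m, f m = 0) ∨ ∀ m, f m = m
  relProjective : IsRelProjective ρ Q
  minimal : ∀ Q' ≤ Q, IsRelProjective ρ Q' → Q' = Q

section BlockAlgebra

variable {O : Type u} [CommRing O] {G : Type} [Group G] {e : MonoidAlgebra O G}

/-- The block algebra `B = O G e` as a ring with identity `e`; it equals `e O G e`, because `e` is
central. -/
abbrev IsBlockIdempotent.Alg (he : IsBlockIdempotent e) : Type u := he.idem.Corner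

/-- The map `g ↦ g e` from `G` to the block algebra `O G e`. -/
def IsBlockIdempotent.of (he : IsBlockIdempotent e) : G →* he.Alg where
  toFun g := ⟨e * single g 1 * e, _, rfl⟩
  map_one' := Subtype.ext (by
    change e * single 1 1 * e = e
    rw [← MonoidAlgebra.one_def, mul_one, he.idem])
  map_mul' g h := Subtype.ext (by
    change e * single (g * h) 1 * e = e * single g 1 * e * (e * single h 1 * e)
    have h1 : (single (g * h) 1 : MonoidAlgebra O G) = single g 1 * single h 1 := by
      simp [MonoidAlgebra.single_mul_single]
    have h2 : e * e = e := he.idem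
    rw [h1, he.central (single g 1 * single h 1), he.central (single g 1),
      he.central (single h 1), mul_assoc _ e e, mul_assoc _ e e, mul_assoc _ e e, h2,
      mul_assoc (single g 1) e, ← mul_assoc e, he.central (single h 1), mul_assoc (single h 1),
      h2, mul_assoc])

/-- A `B`-`B`-bimodule `M` as an `O (G × G)`-module: `(g, h) · m = g m h⁻¹`. -/
def IsBlockIdempotent.rep (he : IsBlockIdempotent e) (M : BimoduleOver O he.Alg) :
    Representation O (G × G) M.carrier where
  toFun x :=
    { toFun := fun m => he.of x.1 • MulOpposite.op (he.of x.2⁻¹) • m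
      map_add' := fun m n => by simp
      map_smul' := fun c m => by
        rw [RingHom.id_apply, smul_comm _ c, smul_comm _ c] }
  map_one' := by ext m; simp
  map_mul' x y := by
    ext m
    simp [mul_smul, smul_comm (he.of y.1) (MulOpposite.op _)]

end BlockAlgebra

section Characters

variable (O : Type u) [CommRing O] {K : Type u} [Field K] [Algebra O K]

theorem exists_algebraMap_eq [IsIntegrallyClosed O] [IsFractionRing O K] {H : Type*} [Group H]
    [Finite H] (χ : H →* Kˣ) (h : H) : ∃ y : O, algebraMap O K y = χ h := by
  refine IsIntegrallyClosed.isIntegral_iff.1 (IsIntegral.of_pow (n := Nat.card H) Nat.card_pos ?_)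
  rw [← Units.val_pow_eq_pow_val, ← map_pow, pow_card_eq_one']
  simpa using isIntegral_one

variable [IsDomain O] [IsIntegrallyClosed O] [IsFractionRing O K]

/-- A linear character of a finite group with values in `K`, as a character with values in `O`: the
values are roots of unity and hence lie in the integrally closed ring `O`. -/
def integralChar {H : Type*} [Group H] [Finite H] (χ : H →* Kˣ) : H →* Oˣ :=
  MonoidHom.toHomUnits
    { toFun := fun h => (exists_algebraMap_eq O χ h).choose
      map_one' := IsFractionRing.injective O K (by
        rw [(exists_algebraMap_eq O χ 1).choose_spec]; simp)
      map_mul' := fun g h => IsFractionRing.injective O K (by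
        rw [(exists_algebraMap_eq O χ (g * h)).choose_spec, map_mul (algebraMap O K),
          (exists_algebraMap_eq O χ g).choose_spec, (exists_algebraMap_eq O χ h).choose_spec]
        simp) }

theorem algebraMap_integralChar {H : Type*} [Group H] [Finite H] (χ : H →* Kˣ) (h : H) :
    algebraMap O K (integralChar O χ h) = χ h :=
  (exists_algebraMap_eq O χ h).choose_spec

/-- The character idempotent `e_φ = |Z|⁻¹ ∑ φ(z⁻¹) z`, for a linear character `φ` of a subgroup `Z`
whose order is invertible in `O`, as an element of `O G`. -/
def charIdempotent {G : Type} [Group G] [Finite G] (Z : Subgroup G) (φ : Z →* Kˣ) :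
    MonoidAlgebra O G :=
  Ring.inverse (Nat.card Z : O) • ∑ᶠ z : Z, single (z : G) (integralChar O φ z⁻¹ : O)

/-- The algebra endomorphism `g ↦ lam(g) g` of `O G`; an `O G`-module `V` twisted by it is the tensor
product over `O` of `V` with the linear character `lam`. -/
def tensorChar {G : Type} [Group G] [Finite G] (lam : G →* Kˣ) :
    MonoidAlgebra O G →ₐ[O] MonoidAlgebra O G :=
  MonoidAlgebra.lift O (MonoidAlgebra O G) G
    { toFun := fun g => single g (integralChar O lam g : O)
      map_one' := by simp [MonoidAlgebra.one_def]
      map_mul' := fun g h => by simp [MonoidAlgebra.single_mul_single] }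

end Characters

section Tensoring

variable {O : Type u} [CommRing O] [IsDomain O] [IsIntegrallyClosed O]
  {K : Type u} [Field K] [Algebra O K] [IsFractionRing O K]
  {G : Type} [Group G] [Finite G] {e : MonoidAlgebra O G}

/-- The endomorphism `g e ↦ lam(g) g e` of the block algebra `B = O G e`, if `g ↦ lam(g) g` fixes
`e`. The twist of a `B`-module `V` by it is the tensor product of `V` with the linear character
`lam`. -/
def IsBlockIdempotent.tensorEnd (he : IsBlockIdempotent e) (lam : G →* Kˣ)
    (h : tensorChar O lam e = e) : he.Alg →ₐ[O] he.Alg :=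
  cornerMap he.idem (tensorChar O lam) h

/-- The `B`-`B`-bimodule that is `B` with its left module structure tensored with `lam`. -/
abbrev IsBlockIdempotent.tensorBimod (he : IsBlockIdempotent e) (lam : G →* Kˣ)
    (h : tensorChar O lam e = e) : BimoduleOver O he.Alg :=
  BimoduleOver.twist (he.tensorEnd lam h)

end Tensoring

end Blocks

section Groups

variable (ℓ : ℕ) [NeZero ℓ]

/-- The homomorphism from the cyclic group of order `m` that maps the generator to `x`. -/
def cyclicHom {U : Type*} [CommGroup U] (m : ℕ) [NeZero m] (x : U) (hx : x ^ m = 1) :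
    Multiplicative (ZMod m) →* U where
  toFun a := x ^ a.toAdd.val
  map_one' := by simp
  map_mul' a b := by
    rw [toAdd_mul, ZMod.val_add, ← pow_eq_pow_mod _ hx, pow_add]

/-- The reduction `ℤ/ℓ² → ℤ/ℓ`. -/
def reduceHom : ZMod (ℓ ^ 2) →+* ZMod ℓ := ZMod.castHom (dvd_pow_self ℓ two_ne_zero) (ZMod ℓ)

/-- The group `⟨z⟩ × ⟨g⟩ ≅ C_ℓ × C_{ℓ²}`. -/
abbrev BaseGroup : Type := Multiplicative (ZMod ℓ) × Multiplicative (ZMod (ℓ ^ 2))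

/-- The action of `⟨h⟩ ≅ C_ℓ` on `⟨z⟩ × ⟨g⟩` with `h z h⁻¹ = z` and `h g h⁻¹ = g z`, that is,
`h^c (z^a g^b) h^{-c} = z^{a + c b} g^b`. -/
def baseAction : Multiplicative (ZMod ℓ) →* MulAut (BaseGroup ℓ) where
  toFun c :=
    { toFun := fun x =>
        (Multiplicative.ofAdd (x.1.toAdd + c.toAdd * reduceHom ℓ x.2.toAdd), x.2)
      invFun := fun x =>
        (Multiplicative.ofAdd (x.1.toAdd - c.toAdd * reduceHom ℓ x.2.toAdd), x.2)
      left_inv := fun x => by simp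
      right_inv := fun x => by simp
      map_mul' := fun x y => Prod.ext
        (Multiplicative.toAdd.injective (by simp [mul_add]; abel)) rfl }
  map_one' := MulEquiv.ext fun x => Prod.ext (by simp) rfl
  map_mul' c d := MulEquiv.ext fun x => Prod.ext
    (Multiplicative.toAdd.injective (by simp [add_mul]; abel)) rfl

/-- The group `E = (⟨z⟩ × ⟨g⟩) ⋊ ⟨h⟩ ≅ (C_ℓ × C_{ℓ²}) ⋊ C_ℓ`. -/
abbrev GroupE : Type := BaseGroup ℓ ⋊[baseAction ℓ] Multiplicative (ZMod ℓ)

/-- The generator `z` of `E`. -/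
def elemz : GroupE ℓ := SemidirectProduct.inl (Multiplicative.ofAdd 1, 1)

/-- The generator `g` of `E`. -/
def elemg : GroupE ℓ := SemidirectProduct.inl (1, Multiplicative.ofAdd 1)

/-- The generator `h` of `E`. -/
def elemh : GroupE ℓ := SemidirectProduct.inr (Multiplicative.ofAdd 1)

/-- The homomorphism from `E` to a commutative group with `z ↦ 1`, `g ↦ x` and `h ↦ y`. -/
def homE {U : Type*} [CommGroup U] (x y : U) (hx : x ^ ℓ ^ 2 = 1) (hy : y ^ ℓ = 1) :
    GroupE ℓ →* U :=
  SemidirectProduct.lift ((cyclicHom (ℓ ^ 2) x hx).comp (MonoidHom.snd _ _)) (cyclicHom ℓ y hy)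
    (fun c => MonoidHom.ext fun n => by simp [baseAction])

variable (p : ℕ) [Fact p.Prime]

/-- The field with `p^n` elements, where `n` is the multiplicative order of `p` modulo `ℓ²`. -/
abbrev FieldF : Type := GaloisField p (orderOf (p : ZMod (ℓ ^ 2)))

/-- The group `D = D₁ × D₂`, where `D₁` and `D₂` are the additive group of the field with `p^n`
elements. -/
abbrev GroupD : Type := Multiplicative (FieldF ℓ p) × Multiplicative (FieldF ℓ p)

/-- A unit of a field acts on the additive group by multiplication. -/
def unitAction (F : Type) [Field F] : Fˣ →* MulAut (Multiplicative F) where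
  toFun c := AddEquiv.toMultiplicative (DistribMulAction.toAddEquiv F c)
  map_one' := by ext x; simp
  map_mul' c d := by ext x; simp [mul_smul]

variable {p} (ω : (FieldF ℓ p)ˣ) (hω : IsPrimitiveRoot ω (ℓ ^ 2))

/-- The action of `E` on `D = D₁ × D₂`. On both factors `z` acts trivially and `g` acts as
multiplication by `ω`. On `D₁` the element `h` acts trivially, so that the kernel is `⟨z⟩ × ⟨h⟩`. On
`D₂` it acts as multiplication by `ω^{-ℓ}`, so that `g^ℓ h` acts trivially and the kernel is
`⟨z⟩ × ⟨g^ℓ h⟩`. -/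
def actionE : GroupE ℓ →* MulAut (GroupD ℓ p) where
  toFun x := MulEquiv.prodCongr
    (unitAction _ (homE ℓ ω 1 hω.pow_eq_one (one_pow ℓ) x))
    (unitAction _ (homE ℓ ω (ω ^ ℓ)⁻¹ hω.pow_eq_one
      (by rw [inv_pow, ← pow_mul, ← sq, hω.pow_eq_one, inv_one]) x))
  map_one' := by
    simp only [map_one]
    rfl
  map_mul' x y := by
    simp only [map_mul]
    rfl

/-- The group `G = D ⋊ E`. -/
abbrev GroupG : Type := GroupD ℓ p ⋊[actionE ℓ ω hω] GroupE ℓ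

instance : Finite (GroupE ℓ) := Finite.of_equiv _ SemidirectProduct.equivProd.symm

instance : Finite (GroupG ℓ ω hω) := Finite.of_equiv _ SemidirectProduct.equivProd.symm

/-- `D` as a subgroup of `G`. -/
def subD : Subgroup (GroupG ℓ ω hω) := SemidirectProduct.inl.range

/-- `Z = ⟨z⟩` as a subgroup of `G`. -/
def subZ : Subgroup (GroupG ℓ ω hω) := Subgroup.zpowers (SemidirectProduct.inr (elemz ℓ))

/-- `F = ⟨z⟩ × ⟨g^ℓ⟩ × ⟨h⟩`, the subgroup of `E` generated by `z`, `g^ℓ` and `h`. -/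
def subF : Subgroup (GroupE ℓ) := Subgroup.closure {elemz ℓ, elemg ℓ ^ ℓ, elemh ℓ}

/-- `D ⋊ F`, the preimage of `F` under `G → E`. -/
def subDF : Subgroup (GroupG ℓ ω hω) := (subF ℓ).comap SemidirectProduct.rightHom

/-- The diagonal subgroup `ΔD` of `G × G`. -/
def diagD : Subgroup (GroupG ℓ ω hω × GroupG ℓ ω hω) :=
  (subD ℓ ω hω).map ((MonoidHom.id _).prod (MonoidHom.id _))

end Groups

end PicardBlock

end

open PicardBlock

/-! Let π : G → E be the projection and T : OG → kE the reduction it induces. Since ker π = D is a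
p-group, T detects idempotents that commute with D (`eq_zero_of_reduction_eq_zero`). Counting
D-conjugacy orbits modulo p shows that T sends every element commuting with D to an element
supported on π(C_G(D)) (`coeff_mapDomain_eq_zero`). An element of E that is trivial on D₁ and D₂ is
a power of z, so C_G(D) = DZ, and an element of B commuting with D therefore has image c · T(e_φ)
with c in k (`exists_reduction_eq_smul`).

This one fact is used several times. A central idempotent below e_φ has c² = c, so e_φ is a block
idempotent. The same argument inside C_G(D) gives the Brauer pair, and the inertial quotient is
abelian because commutators of G lie in DZ. An isomorphism M_λ ≅ B amounts to a unit u of B with gu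
= λ(g)ug. Such a u commutes with D, so T(u) = c · T(e_φ) with c ≠ 0, and then λ(g) ≡ 1 modulo the
maximal ideal for all g. This fails for a nontrivial ℓ-th root of unity, as ℓ ≠ p.

The defect group and the vertex rest on the coefficient 1/|Z| of e_φ at 1, a unit of O: it can be
nonzero modulo the maximal ideal only if nothing smaller than D suffices
(`isDefectGroup_charIdempotent`, `IsRelProjective.eq_of_le`). Projectivity relative to ΔD is
Higman's criterion with an explicit endomorphism, and indecomposability holds because endomorphisms
of M_λ are multiplications by central elements of B.

For the action on characters, let V be a simple KB-module, ζ = φ(z) the scalar by which z acts, and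
ψ a character of D occurring in V. If ψ is nontrivial on D₁ and on D₂, its stabilizer is DZ, on
which λ is trivial, and a λ-weighted sum of conjugates of the projection to ψ intertwines V with its
twist (`exists_intertwiner_of_character`). Otherwise D₂ or D₁ acts trivially on V, and t = h or t =
g^ℓ h commutes with h and with the image of D, while tg = gzt. Then t^j with ζ^j = λ(g) intertwines
(`exists_intertwiner_of_element`). The operator depends on V, and no unit of B serves for all V at
once. -/

namespace PicardBlock

open MonoidAlgebra (single)

/-! ### p-groups acting on objects of characteristic p -/

section PGroups

variable {p : ℕ} [Fact p.Prime]

/-- A function with values in characteristic `p` that is invariant under a fixed point free action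
of a `p`-group has sum zero. -/
theorem sum_eq_zero_of_isPGroup {k P X : Type*} [Ring k] [CharP k p] [Group P]
    (hP : IsPGroup p P) [Fintype X] [MulAction P X] (F : X → k)
    (hF : ∀ (g : P) x, F (g • x) = F x) (hX : ∀ x : X, ∃ g : P, g • x ≠ x) :
    ∑ x, F x = 0 := by
  classical
  -- The sum splits over orbits, on which `F` is constant; an orbit without fixed points has p^n
  -- elements with n > 0, so it contributes a multiple of p.
  rw [← Finset.sum_fiberwise Finset.univ (Quotient.mk (MulAction.orbitRel P X)) F]
  refine Finset.sum_eq_zero fun q _ => ?_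
  induction q using Quotient.inductionOn with
  | h a =>
  have hmem : ∀ x : X, Quotient.mk (MulAction.orbitRel P X) x = Quotient.mk _ a ↔
      x ∈ MulAction.orbit P a := fun x => by
    rw [Quotient.eq, MulAction.orbitRel_apply]
  have hconst : ∀ x ∈ Finset.univ.filter
      (fun x : X => Quotient.mk (MulAction.orbitRel P X) x = Quotient.mk _ a), F x = F a := by
    intro x hx
    obtain ⟨g, rfl⟩ := (hmem x).1 (Finset.mem_filter.1 hx).2
    exact hF g a
  rw [Finset.sum_congr rfl hconst, Finset.sum_const]
  obtain ⟨n, hn⟩ := hP.card_orbit a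
  have hcard : (Finset.univ.filter
      (fun x : X => Quotient.mk (MulAction.orbitRel P X) x = Quotient.mk _ a)).card = p ^ n := by
    rw [← hn, Nat.card_eq_fintype_card, ← Set.toFinset_card]
    congr 1
    ext x
    simp [hmem]
  have hn0 : n ≠ 0 := by
    rintro rfl
    obtain ⟨g, hg⟩ := hX a
    rw [pow_zero, Nat.card_eq_one_iff_unique] at hn
    have := hn.1
    exact hg (congrArg Subtype.val (Subsingleton.elim
      (⟨g • a, ⟨g, rfl⟩⟩ : MulAction.orbit P a) ⟨a, MulAction.mem_orbit_self a⟩))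
  rw [hcard, nsmul_eq_mul, Nat.cast_pow, CharP.cast_eq_zero, zero_pow hn0, zero_mul]

/-- If a finite `p`-group acts by left multiplication on a ring of characteristic `p`, then there is
a nonzero fixed vector in the additive subgroup generated by any nonzero orbit. -/
theorem exists_fixed_ne_zero {P A : Type*} [Group P] [Finite P] (hP : IsPGroup p P)
    [Ring A] (σ : P →* A) (hpA : ∀ v : A, p • v = 0) {v : A} (hv : v ≠ 0) :
    ∃ w ∈ AddSubgroup.closure (Set.range fun g => σ g * v), w ≠ 0 ∧ ∀ g : P, σ g * w = w := by
  set S := AddSubgroup.closure (Set.range fun g => σ g * v) with hS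
  -- `S` is finitely generated because `P` is finite, and it is killed by p.
  have hfin : Finite S := by
    have : AddGroup.FG S := (AddGroup.fg_iff_addSubgroup_fg S).2
      ((AddSubgroup.fg_iff S).2 ⟨_, rfl, Set.finite_range _⟩)
    refine AddCommGroup.finite_of_fg_isAddTorsion S fun x => ?_
    rw [isOfFinAddOrder_iff_nsmul_eq_zero]
    exact ⟨p, (Fact.out : p.Prime).pos, Subtype.ext (hpA _)⟩
  have hstab : ∀ (g : P), ∀ w ∈ S, σ g * w ∈ S := by
    intro g w hw
    induction hw using AddSubgroup.closure_induction with
    | mem x hx =>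
      obtain ⟨h, rfl⟩ := hx
      exact AddSubgroup.subset_closure ⟨g * h, by simp only [map_mul, mul_assoc]⟩
    | zero => rw [mul_zero]; exact S.zero_mem
    | add x y _ _ hx hy => rw [mul_add]; exact S.add_mem hx hy
    | neg x _ hx => rw [mul_neg]; exact S.neg_mem hx
  let act : MulAction P S :=
    { smul := fun g w => ⟨σ g * w.1, hstab g w.1 w.2⟩
      one_smul := fun w => Subtype.ext (by
        change σ 1 * w.1 = w.1
        rw [map_one, one_mul])
      mul_smul := fun g h w => Subtype.ext (by
        change σ (g * h) * w.1 = σ g * (σ h * w.1)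
        rw [map_mul, mul_assoc]) }
  have hvS : v ∈ S := AddSubgroup.subset_closure ⟨1, by simp⟩
  -- The number of fixed points is congruent to |S| modulo p, hence divisible by p; as 0 is fixed,
  -- there is another one.
  have hdvd : p ∣ Nat.card S := by
    have h1 : addOrderOf (⟨v, hvS⟩ : S) = p :=
      addOrderOf_eq_prime (Subtype.ext (hpA v)) (fun h => hv (congrArg Subtype.val h))
    rw [← h1]
    exact addOrderOf_dvd_natCard _
  obtain ⟨w, hw, hw0⟩ := hP.exists_fixed_point_of_prime_dvd_card_of_fixed_point S hdvd
    (a := 0) (fun g => Subtype.ext (mul_zero _))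
  exact ⟨w.1, w.2, fun h => hw0 (Subtype.ext h.symm), fun g => congrArg Subtype.val (hw g)⟩

end PGroups

/-! ### The group algebra modulo a normal p-subgroup, in characteristic p -/

section GroupAlgebra

theorem coeff_mapDomain_eq_sum {k G E : Type*} [Semiring k] [Fintype G] [DecidableEq E] (π : G → E)
    (f : MonoidAlgebra k G) (y : E) :
    (MonoidAlgebra.mapDomain π f).coeff y = ∑ x : {x // π x = y}, f.coeff x := by
  classical
  rw [MonoidAlgebra.mapDomain, Finsupp.mapDomain, Finsupp.sum_apply,
    Finsupp.sum_fintype _ _ (by simp)]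
  simp only [Finsupp.single_apply]
  rw [← Finset.sum_filter]
  exact Finset.sum_subtype _ (by simp) _

variable {k G E : Type*} [CommRing k] [Group G] [Group E]

theorem conj_coeff_of_commute {f : MonoidAlgebra k G} {n : G}
    (hf : single n 1 * f = f * single n 1) (x : G) : f.coeff (n * x * n⁻¹) = f.coeff x := by
  have h := congrArg (fun a => a.coeff (n * x)) hf
  simp only [MonoidAlgebra.coeff_single_mul_apply, MonoidAlgebra.coeff_mul_single_apply, one_mul,
    mul_one, inv_mul_cancel_left] at h
  exact h.symm

variable {p : ℕ} [Fact p.Prime] [CharP k p]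

/-- If `f` commutes with the `p`-group `ker π`, then its image under `π` is supported on the image
of the centralizer of `ker π`. -/
theorem coeff_mapDomain_eq_zero [Finite G] (π : G →* E) (hN : IsPGroup p π.ker)
    {f : MonoidAlgebra k G} (hf : ∀ n ∈ π.ker, single n 1 * f = f * single n 1) {y : E}
    (hy : ∀ x, π x = y → x ∉ Subgroup.centralizer (π.ker : Set G)) :
    (MonoidAlgebra.mapDomain π f).coeff y = 0 := by
  classical
  have := Fintype.ofFinite G
  rw [coeff_mapDomain_eq_sum]
  -- The kernel acts by conjugation on the fibre over `y`, and its fixed points there are the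
  -- elements of the centralizer, of which there are none.
  let act : MulAction π.ker {x // π x = y} :=
    { smul := fun n x => ⟨n.1 * x.1 * n.1⁻¹, by
        rw [map_mul, map_mul, map_inv, n.2, x.2, one_mul, inv_one, mul_one]⟩
      one_smul := fun x => Subtype.ext (by
        change (1 : G) * x.1 * (1 : G)⁻¹ = x.1
        simp)
      mul_smul := fun m n x => Subtype.ext (by
        change (m.1 * n.1) * x.1 * (m.1 * n.1)⁻¹ = m.1 * (n.1 * x.1 * n.1⁻¹) * m.1⁻¹
        group) }
  refine sum_eq_zero_of_isPGroup hN (fun x : {x // π x = y} => f.coeff x)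
    (fun n x => conj_coeff_of_commute (hf n.1 n.2) x.1) fun x => ?_
  by_contra! h
  refine hy x.1 x.2 (Subgroup.mem_centralizer_iff.2 fun n hn => ?_)
  have h1 : n * x.1 * n⁻¹ = x.1 := congrArg Subtype.val (h ⟨n, hn⟩)
  exact mul_inv_eq_iff_eq_mul.1 h1

/-- An idempotent of the group algebra in characteristic `p` that commutes with the `p`-group
`ker π` vanishes if its image under `π` vanishes. -/
theorem eq_zero_of_mapDomain_eq_zero [Finite G] (π : G →* E) (hN : IsPGroup p π.ker)
    {f : MonoidAlgebra k G} (hid : f * f = f)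
    (hf : ∀ n ∈ π.ker, single n 1 * f = f * single n 1)
    (h0 : MonoidAlgebra.mapDomain π f = 0) : f = 0 := by
  classical
  by_contra hne
  -- A nonzero combination `w` of translates n f that is fixed by ker π. Each translate satisfies f
  -- · n f = n f, so f w = w; on the other hand f w depends only on the image of f under π, which is
  -- 0.
  obtain ⟨w, hw, hw0, hfix⟩ := exists_fixed_ne_zero hN
    ((MonoidAlgebra.of k G).comp π.ker.subtype) (fun v => by
      rw [← Nat.cast_smul_eq_nsmul k, CharP.cast_eq_zero, zero_smul]) hne
  replace hfix : ∀ n ∈ π.ker, single n 1 * w = w := fun n hn => hfix ⟨n, hn⟩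
  have hfw : f * w = w := by
    clear hfix hw0
    induction hw using AddSubgroup.closure_induction with
    | mem x hx =>
      obtain ⟨n, rfl⟩ := hx
      change f * (single n.1 1 * f) = single n.1 1 * f
      rw [hf n.1 n.2, ← mul_assoc, hid]
    | zero => rw [mul_zero]
    | add x y _ _ hx hy => rw [mul_add, hx, hy]
    | neg x _ hx => rw [mul_neg, hx]
  have hfac : Function.FactorsThrough (fun x : G => single x (1 : k) * w) π := by
    intro x y hxy
    have hn : x⁻¹ * y ∈ π.ker := by rw [MonoidHom.mem_ker, map_mul, map_inv, hxy, inv_mul_cancel]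
    change single x 1 * w = single y 1 * w
    rw [← hfix _ hn, ← mul_assoc, MonoidAlgebra.single_mul_single, hfix _ hn]
    simp
  -- The value of x w as a function of π x; off the image of π it is 0, a value that plays no role.
  let U := Function.extend π (fun x : G => single x (1 : k) * w) 0
  have hsum : f * w = f.coeff.sum fun x r => r • U (π x) := by
    conv_lhs => rw [← MonoidAlgebra.sum_coeff_single f]
    rw [Finsupp.sum_mul]
    refine Finsupp.sum_congr fun x _ => ?_
    rw [show U (π x) = single x 1 * w from hfac.extend_apply _ x, ← smul_mul_assoc,
      MonoidAlgebra.smul_single, smul_eq_mul, mul_one]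
  have h1 : (MonoidAlgebra.mapDomain π f).coeff.sum (fun y r => r • U y) =
      f.coeff.sum fun x r => r • U (π x) :=
    Finsupp.sum_mapDomain_index (by simp) (by simp [add_smul])
  rw [h0] at h1
  rw [hfw, ← h1] at hsum
  exact hw0 (by simpa using hsum)

end GroupAlgebra

/-! ### Reduction from O G to k E -/

section Reduction

variable {O G E : Type*} [CommRing O] [IsLocalRing O] [Group G] [Group E]

variable (O) in
/-- The homomorphism from the group algebra `O G` to `k E` that is induced by a homomorphism from
`G` to `E`, where `k` is the residue field of `O`. -/
noncomputable def reduction (π : G →* E) :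
    MonoidAlgebra O G →+* MonoidAlgebra (IsLocalRing.ResidueField O) E :=
  (MonoidAlgebra.mapDomainRingHom _ π).comp (MonoidAlgebra.mapRingHom G (IsLocalRing.residue O))

theorem reduction_apply (π : G →* E) (f : MonoidAlgebra O G) : reduction O π f =
    MonoidAlgebra.mapDomain π (MonoidAlgebra.mapRingHom G (IsLocalRing.residue O) f) := rfl

theorem reduction_single (π : G →* E) (x : G) (r : O) :
    reduction O π (single x r) = single (π x) (IsLocalRing.residue O r) := by
  simp [reduction_apply]

theorem reduction_smul (π : G →* E) (r : O) (f : MonoidAlgebra O G) :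
    reduction O π (r • f) = IsLocalRing.residue O r • reduction O π f := by
  have h : ∀ a : MonoidAlgebra O G, r • a = single 1 r * a := fun a => by ext; simp
  have h' : ∀ (c : IsLocalRing.ResidueField O) (a : MonoidAlgebra _ E), c • a = single 1 c * a :=
    fun c a => by ext; simp
  rw [h, h', map_mul, reduction_single, map_one]

theorem commute_mapRingHom {n : G} {f : MonoidAlgebra O G}
    (hf : single n 1 * f = f * single n 1) :
    single n 1 * MonoidAlgebra.mapRingHom G (IsLocalRing.residue O) f =
      MonoidAlgebra.mapRingHom G (IsLocalRing.residue O) f * single n 1 := by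
  have h := congrArg (MonoidAlgebra.mapRingHom G (IsLocalRing.residue O)) hf
  simpa only [map_mul, MonoidAlgebra.mapRingHom_single, map_one] using h

variable {p : ℕ} [Fact p.Prime] [CharP (IsLocalRing.ResidueField O) p]

/-- The statement over the residue field gives f ≡ 0 modulo the maximal ideal. Then f = f² moves the
coefficients from each power of the ideal into the next one, and Krull's intersection theorem
concludes. -/
theorem eq_zero_of_reduction_eq_zero [IsDomain O] [IsNoetherianRing O] [Finite G] (π : G →* E)
    (hN : IsPGroup p π.ker)
    {f : MonoidAlgebra O G} (hid : f * f = f)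
    (hf : ∀ n ∈ π.ker, single n 1 * f = f * single n 1) (h0 : reduction O π f = 0) : f = 0 := by
  classical
  have hmap := eq_zero_of_mapDomain_eq_zero (p := p) π hN
    (f := MonoidAlgebra.mapRingHom G (IsLocalRing.residue O) f) (by rw [← map_mul, hid])
    (fun n hn => commute_mapRingHom (hf n hn)) h0
  have hmem : ∀ m : ℕ, ∀ x, f.coeff x ∈ IsLocalRing.maximalIdeal O ^ m := by
    intro m
    induction m with
    | zero => simp
    | succ m ih =>
      intro x
      rw [← hid, MonoidAlgebra.coeff_mul]
      refine Submodule.sum_mem _ fun a _ => Submodule.sum_mem _ fun b _ => ?_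
      dsimp only
      split_ifs
      · rw [pow_succ]
        refine Ideal.mul_mem_mul (ih a) ?_
        rw [← IsLocalRing.residue_eq_zero_iff, ← MonoidAlgebra.coeff_mapRingHom, hmap]
        rfl
      · exact zero_mem _
  ext x
  have h1 : f.coeff x ∈ ⨅ m, IsLocalRing.maximalIdeal O ^ m :=
    (Submodule.mem_iInf _).2 fun m => hmem m x
  rwa [Ideal.iInf_pow_eq_bot_of_isLocalRing _ (IsLocalRing.maximalIdeal.isMaximal O).ne_top] at h1

end Reduction

theorem central_of_forall_single {R G : Type*} [CommRing R] [Group G] {f : MonoidAlgebra R G}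
    (h : ∀ x : G, single x 1 * f = f * single x 1) (a : MonoidAlgebra R G) : f * a = a * f := by
  have hs : ∀ (x : G) (r : R), single x r = r • single x (1 : R) := fun x r => by simp
  induction a using MonoidAlgebra.induction_linear with
  | zero => simp
  | add a b ha hb => rw [mul_add, add_mul, ha, hb]
  | single x r => rw [hs, mul_smul_comm, smul_mul_assoc, h]

/-! ### Character idempotents -/

section CharIdempotent

variable {O : Type u} [CommRing O] [IsDomain O] [IsIntegrallyClosed O]
  {K : Type u} [Field K] [Algebra O K] [IsFractionRing O K]
  {G : Type} [Group G] [Finite G] {Z : Subgroup G} (φ : Z →* Kˣ)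

theorem charIdempotent_eq_sum [Fintype Z] : charIdempotent O Z φ =
    Ring.inverse (Nat.card Z : O) • ∑ z : Z, single (z : G) (integralChar O φ z⁻¹ : O) := by
  rw [charIdempotent, finsum_eq_sum_of_fintype]

theorem coeff_charIdempotent_of_mem (z : Z) : (charIdempotent O Z φ).coeff z =
    Ring.inverse (Nat.card Z : O) * (integralChar O φ z⁻¹ : O) := by
  classical
  have := Fintype.ofFinite Z
  rw [charIdempotent_eq_sum, MonoidAlgebra.coeff_smul_apply, MonoidAlgebra.coeff_sum,
    Finsupp.finsetSum_apply, Finset.sum_eq_single z, smul_eq_mul]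
  · simp
  · intro w _ hw
    simp [hw]
  · simp

theorem coeff_charIdempotent_of_notMem {x : G} (hx : x ∉ Z) :
    (charIdempotent O Z φ).coeff x = 0 := by
  classical
  have := Fintype.ofFinite Z
  rw [charIdempotent_eq_sum, MonoidAlgebra.coeff_smul_apply, MonoidAlgebra.coeff_sum,
    Finsupp.finsetSum_apply, Finset.sum_eq_zero, smul_zero]
  intro w _
  have : (w : G) ≠ x := fun h => hx (h ▸ w.2)
  simp [this]

theorem coeff_one_charIdempotent :
    (charIdempotent O Z φ).coeff 1 = Ring.inverse (Nat.card Z : O) := by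
  have h := coeff_charIdempotent_of_mem (O := O) φ (1 : Z)
  simpa using h

theorem single_mul_charIdempotent (z : Z) : single (z : G) 1 * charIdempotent O Z φ =
    (integralChar O φ z : O) • charIdempotent O Z φ := by
  have := Fintype.ofFinite Z
  rw [charIdempotent_eq_sum, mul_smul_comm, smul_comm]
  refine congrArg (fun a : MonoidAlgebra O G => Ring.inverse (Nat.card Z : O) • a) ?_
  rw [Finset.mul_sum, Finset.smul_sum]
  refine Fintype.sum_equiv (Equiv.mulLeft z) _ _ fun w => ?_
  simp only [MonoidAlgebra.single_mul_single, one_mul, map_inv, Equiv.coe_mulLeft,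
    Subgroup.coe_mul, map_mul, mul_inv_rev, Units.val_mul, MonoidAlgebra.smul_single, smul_eq_mul]
  rw [mul_left_comm, Units.mul_inv, mul_one]

theorem single_mul_charIdempotent_comm (hZ : Z ≤ Subgroup.center G) (x : G) :
    single x 1 * charIdempotent O Z φ = charIdempotent O Z φ * single x 1 := by
  have := Fintype.ofFinite Z
  rw [charIdempotent_eq_sum, mul_smul_comm, smul_mul_assoc, Finset.mul_sum, Finset.sum_mul]
  congr 1
  refine Finset.sum_congr rfl fun z _ => ?_
  rw [MonoidAlgebra.single_mul_single, MonoidAlgebra.single_mul_single,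
    Subgroup.mem_center_iff.1 (hZ z.2) x, mul_comm (1 : O)]

variable (hu : IsUnit (Nat.card Z : O))
include hu

theorem charIdempotent_mul_self :
    charIdempotent O Z φ * charIdempotent O Z φ = charIdempotent O Z φ := by
  have := Fintype.ofFinite Z
  conv_lhs => enter [1]; rw [charIdempotent_eq_sum]
  rw [smul_mul_assoc, Finset.sum_mul]
  have h : ∀ z : Z, single (z : G) (integralChar O φ z⁻¹ : O) * charIdempotent O Z φ =
      charIdempotent O Z φ := fun z => by
    have h1 : single (z : G) (integralChar O φ z⁻¹ : O) =
      (integralChar O φ z⁻¹ : O) • single (z : G) 1 := by simp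
    rw [h1, smul_mul_assoc, single_mul_charIdempotent, smul_smul, ← Units.val_mul, ← map_mul]
    simp
  rw [Finset.sum_congr rfl fun z _ => h z, Finset.sum_const, Finset.card_univ,
    ← Nat.card_eq_fintype_card, ← Nat.cast_smul_eq_nsmul O, smul_smul, Ring.inverse_mul_cancel _ hu,
    one_smul]

/-- That this coefficient survives reduction is what excludes smaller defect groups and vertices,
and it also shows that the Brauer image of the idempotent is nonzero. -/
theorem isUnit_coeff_one_charIdempotent : IsUnit ((charIdempotent O Z φ).coeff 1) := by
  rw [coeff_one_charIdempotent]
  exact hu.ringInverse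

theorem charIdempotent_ne_zero : charIdempotent O Z φ ≠ 0 := fun h => by
  have h1 := isUnit_coeff_one_charIdempotent φ hu
  rw [h] at h1
  simp at h1

end CharIdempotent

/-! ### Block, defect group and inertial quotient -/

section Block

variable {O : Type u} [CommRing O] [IsDomain O] [IsIntegrallyClosed O] [IsLocalRing O]
  {K : Type u} [Field K] [Algebra O K] [IsFractionRing O K]
  {G : Type} [Group G] [Finite G] {E : Type} [Group E] {Z : Subgroup G} (φ : Z →* Kˣ) (π : G →* E)

/-- An element of `k E` supported on the image of `Z` becomes a scalar multiple of the image of the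
character idempotent when it is multiplied by it. -/
theorem exists_mul_reduction_charIdempotent
    {a : MonoidAlgebra (IsLocalRing.ResidueField O) E}
    (ha : ∀ y, y ∉ Z.map π → a.coeff y = 0) :
    ∃ c : IsLocalRing.ResidueField O, a * reduction O π (charIdempotent O Z φ) =
      c • reduction O π (charIdempotent O Z φ) := by
  suffices h : a * reduction O π (charIdempotent O Z φ) ∈
      Submodule.span (IsLocalRing.ResidueField O) {reduction O π (charIdempotent O Z φ)} by
    obtain ⟨c, hc⟩ := Submodule.mem_span_singleton.1 h
    exact ⟨c, hc.symm⟩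
  rw [← MonoidAlgebra.sum_coeff_single a, Finsupp.sum_mul]
  refine Submodule.sum_mem _ fun y hy => ?_
  obtain ⟨z, hz, rfl⟩ : y ∈ Z.map π := by
    by_contra h
    exact Finsupp.mem_support_iff.1 hy (ha y h)
  have h1 : single (π z) (a.coeff (π z)) = a.coeff (π z) • reduction O π (single z 1) := by
    rw [reduction_single, map_one, MonoidAlgebra.smul_single, smul_eq_mul, mul_one]
  dsimp only
  rw [h1, smul_mul_assoc, ← map_mul, single_mul_charIdempotent φ ⟨z, hz⟩, reduction_smul]
  exact Submodule.smul_mem _ _ (Submodule.smul_mem _ _ (Submodule.mem_span_singleton_self _))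

/-- If `T` detects idempotents and maps the idempotent `f` below the idempotent `e` to a scalar
multiple of `T e`, then `f` is `0` or `e`. -/
theorem eq_zero_or_eq_of_map_eq_smul {k R S : Type*} [Field k] [Ring R] [Ring S] [Algebra k S]
    (T : R →+* S) {e f : R} (he : e * e = e) (hf : f * f = f)
    (hfT : T f = 0 → f = 0) (hefT : T (e - f) = 0 → e - f = 0)
    {c : k} (hc : T f = c • T e) : f = 0 ∨ f = e := by
  by_cases hTf : T f = 0
  · exact Or.inl (hfT hTf)
  right
  have hTe : T f = T e := by
    -- As `T f` is idempotent, c² = c unless `T e = 0`. The cases c = 0 and `T e = 0` contradict `T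
    -- f ≠ 0`, which leaves `T f = T e`.
    have h1 : (c * c - c) • T e = 0 := by
      rw [sub_smul, ← hc, ← hf, map_mul, hc, smul_mul_smul_comm, ← map_mul, he, sub_self]
    rcases smul_eq_zero.1 h1 with h | h
    · rcases mul_eq_zero.1 (show c * (c - 1) = 0 by rw [← h]; ring) with h | h
      · exact absurd (by rw [hc, h, zero_smul]) hTf
      · rw [hc, sub_eq_zero.1 h, one_smul]
    · exact absurd (by rw [hc, h, smul_zero]) hTf
  exact (sub_eq_zero.1 (hefT (by rw [map_sub, hTe, sub_self]))).symm

variable {p : ℕ} [Fact p.Prime] [CharP (IsLocalRing.ResidueField O) p]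

/-- The image of `f` is supported on π(Z), and the elements of Z act on the character idempotent by
scalars. Only commutation with ker π is needed, not centrality or idempotence: the lemma is also
applied to a unit that implements an isomorphism of bimodules. -/
theorem exists_reduction_eq_smul (hN : IsPGroup p π.ker)
    (hC : ∀ x ∈ Subgroup.centralizer (π.ker : Set G), π x ∈ Z.map π) {f : MonoidAlgebra O G}
    (hf : ∀ n ∈ π.ker, single n 1 * f = f * single n 1) (hfe : f * charIdempotent O Z φ = f) :
    ∃ c : IsLocalRing.ResidueField O, reduction O π f =
      c • reduction O π (charIdempotent O Z φ) := by
  rw [← hfe, map_mul]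
  refine exists_mul_reduction_charIdempotent φ π fun y hy => ?_
  exact coeff_mapDomain_eq_zero π hN (fun n hn => commute_mapRingHom (hf n hn))
    fun x hx hxC => hy (hx ▸ hC x hxC)

/-- The character idempotents of a central subgroup `Z` are block idempotents if `G` has a normal
`p`-subgroup whose centralizer is contained in its product with `Z`. -/
theorem isBlockIdempotent_charIdempotent [IsNoetherianRing O] (hN : IsPGroup p π.ker)
    (hC : ∀ x ∈ Subgroup.centralizer (π.ker : Set G), π x ∈ Z.map π)
    (hZ : Z ≤ Subgroup.center G) (hu : IsUnit (Nat.card Z : O)) :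
    IsBlockIdempotent (charIdempotent O Z φ) where
  idem := charIdempotent_mul_self φ hu
  central := central_of_forall_single (single_mul_charIdempotent_comm φ hZ)
  ne_zero := charIdempotent_ne_zero φ hu
  primitive f hf hcent hfe := by
    have hcen : ∀ n, single n 1 * f = f * single n 1 := fun n => (hcent _).symm
    have hef : charIdempotent O Z φ * f = f := by rw [← hcent, hfe]
    obtain ⟨c, hc⟩ := exists_reduction_eq_smul φ π hN hC (fun n _ => hcen n) hfe
    refine eq_zero_or_eq_of_map_eq_smul (reduction O π) (charIdempotent_mul_self φ hu) hf
      (eq_zero_of_reduction_eq_zero π hN hf fun n _ => hcen n)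
      (eq_zero_of_reduction_eq_zero π hN ?_ fun n _ => ?_) hc
    · rw [mul_sub, sub_mul, sub_mul, charIdempotent_mul_self φ hu, hfe, hef,
        show f * f = f from hf, sub_self, sub_zero]
    · rw [mul_sub, sub_mul, hcen, single_mul_charIdempotent_comm φ hZ]

/-- The normal `p`-subgroup is a defect group of the block. -/
theorem isDefectGroup_charIdempotent (hN : IsPGroup p π.ker)
    (hZ : Z ≤ Subgroup.center G) (hu : IsUnit (Nat.card Z : O))
    (hi : IsUnit (π.ker.index : O)) :
    IsDefectGroup (charIdempotent O Z φ) π.ker := by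
  have hconj : ∀ x : G, single x 1 * charIdempotent O Z φ * single x⁻¹ 1 =
      charIdempotent O Z φ := fun x => by
    rw [single_mul_charIdempotent_comm φ hZ, mul_assoc, MonoidAlgebra.single_mul_single,
      mul_inv_cancel, one_mul, ← MonoidAlgebra.one_def, mul_one]
  refine ⟨⟨Ring.inverse (π.ker.index : O) • charIdempotent O Z φ, fun n _ => ?_, ?_⟩, ?_⟩
  · rw [mul_smul_comm, smul_mul_assoc, single_mul_charIdempotent_comm φ hZ]
  · have := Fintype.ofFinite (G ⧸ π.ker)
    simp only [mul_smul_comm, smul_mul_assoc, hconj]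
    rw [finsum_eq_sum_of_fintype, Finset.sum_const, Finset.card_univ,
      ← Nat.card_eq_fintype_card, ← Subgroup.index, ← Nat.cast_smul_eq_nsmul O, smul_smul,
      Ring.mul_inverse_cancel _ hi, one_smul]
  · rintro Q hQ ⟨a, ha, hsum⟩
    have := Fintype.ofFinite (G ⧸ Q)
    -- The coefficient at 1 is invariant under conjugation, so a trace from Q multiplies it by |G :
    -- Q|.
    have hone : (charIdempotent O Z φ).coeff 1 = (Q.index : O) * a.coeff 1 := by
      rw [← hsum, finsum_eq_sum_of_fintype, MonoidAlgebra.coeff_sum, Finsupp.finsetSum_apply]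
      simp [Subgroup.index, Nat.card_eq_fintype_card]
    have hunit : IsUnit (Q.index : O) :=
      isUnit_of_mul_isUnit_left (hone ▸ isUnit_coeff_one_charIdempotent φ hu)
    have hp : ¬ p ∣ Q.index := fun h => by
      have h1 : (Q.index : IsLocalRing.ResidueField O) = 0 := (CharP.cast_eq_zero_iff _ p _).2 h
      have h2 := hunit.map (IsLocalRing.residue O)
      rw [map_natCast, h1] at h2
      exact not_isUnit_zero h2
    refine le_antisymm hQ (Subgroup.relIndex_eq_one.1 ?_)
    -- The index of Q in ker π is a power of p that divides |G : Q|, which is prime to p.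
    obtain ⟨n, hn⟩ := hN.index (Q.subgroupOf π.ker)
    change Q.relIndex π.ker = p ^ n at hn
    rcases Nat.eq_zero_or_pos n with rfl | hpos
    · simpa using hn
    · exact absurd ((dvd_pow_self p hpos.ne').trans (hn ▸ Subgroup.relIndex_dvd_index_of_le hQ)) hp

theorem coeff_brauerMap (P : Subgroup G) (a : MonoidAlgebra O G)
    (c : Subgroup.centralizer (P : Set G)) :
    (brauerMap P a).coeff c = IsLocalRing.residue O (a.coeff (c : G)) := by
  classical
  have := Fintype.ofFinite (Subgroup.centralizer (P : Set G))
  rw [brauerMap, finsum_eq_sum_of_fintype, MonoidAlgebra.coeff_sum, Finsupp.finsetSum_apply,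
    Finset.sum_eq_single c]
  · simp
  · intro d _ hd
    simp [hd]
  · simp

/-- For elements supported on the centralizer the Brauer map is plain reduction of coefficients, so
identities such as idempotence pass to the image by injectivity of the inclusion of group algebras.
-/
theorem mapDomain_brauerMap (P : Subgroup G) (a : MonoidAlgebra O G)
    (ha : ∀ x ∉ Subgroup.centralizer (P : Set G), a.coeff x = 0) :
    MonoidAlgebra.mapDomain (Subgroup.centralizer (P : Set G)).subtype (brauerMap P a) =
      MonoidAlgebra.mapRingHom G (IsLocalRing.residue O) a := by
  ext x
  rw [MonoidAlgebra.coeff_mapRingHom, MonoidAlgebra.mapDomain]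
  by_cases hx : x ∈ Subgroup.centralizer (P : Set G)
  · have h := Finsupp.mapDomain_apply (Subgroup.centralizer (P : Set G)).subtype_injective
      (brauerMap P a).coeff ⟨x, hx⟩
    rw [coeff_brauerMap] at h
    exact h
  · rw [ha x hx, map_zero]
    exact Finsupp.mapDomain_of_notMem_range _ _ fun ⟨y, hy⟩ => hx (hy ▸ y.2)

/-- The argument for the block of G applies to the centralizer and the restriction of π. The support
condition is now automatic, because π maps the whole centralizer into π(Z). -/
theorem isBrauerPair_charIdempotent (hN : IsPGroup p π.ker)
    (hC : ∀ x ∈ Subgroup.centralizer (π.ker : Set G), π x ∈ Z.map π)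
    (hZ : Z ≤ Subgroup.center G) (hu : IsUnit (Nat.card Z : O)) :
    IsBrauerPair (charIdempotent O Z φ) π.ker (brauerMap π.ker (charIdempotent O Z φ)) := by
  set C := Subgroup.centralizer (π.ker : Set G)
  set e := charIdempotent O Z φ with he
  set b := brauerMap π.ker e
  have hinj : Function.Injective (MonoidAlgebra.mapDomainRingHom (IsLocalRing.ResidueField O)
      C.subtype) := MonoidAlgebra.mapDomain_injective C.subtype_injective
  have hZC : Z ≤ C := hZ.trans (Subgroup.center_le_centralizer _)
  have hb : MonoidAlgebra.mapDomainRingHom (IsLocalRing.ResidueField O) C.subtype b =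
      MonoidAlgebra.mapRingHom G (IsLocalRing.residue O) e :=
    mapDomain_brauerMap _ _ fun x hx => coeff_charIdempotent_of_notMem φ fun h => hx (hZC h)
  have hbb : b * b = b := hinj (by
    rw [map_mul, hb, ← map_mul, charIdempotent_mul_self φ hu])
  have hbs : ∀ x : C, single x 1 * b = b * single x 1 := fun x => hinj (by
    rw [map_mul, map_mul, hb]
    simpa using commute_mapRingHom (single_mul_charIdempotent_comm (O := O) φ hZ (x : G)))
  have hker : IsPGroup p (π.comp C.subtype).ker :=
    IsPGroup.comap_subtype (H := π.ker) hN
  have hbred : MonoidAlgebra.mapDomainRingHom (IsLocalRing.ResidueField O) (π.comp C.subtype) b =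
      reduction O π e := by
    rw [MonoidAlgebra.mapDomainRingHom_comp, RingHom.comp_apply, hb]
    rfl
  refine ⟨⟨hbb, central_of_forall_single hbs, fun h0 => ?_, fun f hf hcent hfe => ?_⟩, hbb⟩
  · have h1 : b.coeff 1 = IsLocalRing.residue O (e.coeff 1) := coeff_brauerMap _ _ _
    have h2 := (isUnit_coeff_one_charIdempotent (O := O) φ hu).map (IsLocalRing.residue O)
    rw [h0] at h1
    rw [← he, ← h1] at h2
    exact not_isUnit_zero h2
  · have hcen : ∀ n, single n 1 * f = f * single n 1 := fun n => (hcent _).symm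
    obtain ⟨c, hc⟩ := exists_mul_reduction_charIdempotent (O := O) φ π
      (a := MonoidAlgebra.mapDomainRingHom (IsLocalRing.ResidueField O) (π.comp C.subtype) f)
      fun y hy => Finsupp.mapDomain_of_notMem_range _ _ fun ⟨x, hx⟩ => hy (hx ▸ hC x.1 x.2)
    rw [← he, ← hbred, ← map_mul, hfe] at hc
    have hbf : b * f = f := by rw [← hcent, hfe]
    refine eq_zero_or_eq_of_map_eq_smul _ hbb hf
      (eq_zero_of_mapDomain_eq_zero _ hker hf fun n _ => hcen n)
      (eq_zero_of_mapDomain_eq_zero _ hker ?_ fun n _ => ?_) hc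
    · rw [mul_sub, sub_mul, sub_mul, hbb, hfe, hbf, show f * f = f from hf, sub_self, sub_zero]
    · rw [mul_sub, sub_mul, hcen, hbs]

/-- A commutator of any two elements of G differs from an element of Z by an element of ker π, and
the central subgroup Z lies in the centralizer; the stabilizer of the pair is not needed. -/
theorem hasAbelianInertialQuotient_charIdempotent (hN : IsPGroup p π.ker)
    (hC : ∀ x ∈ Subgroup.centralizer (π.ker : Set G), π x ∈ Z.map π)
    (hZ : Z ≤ Subgroup.center G) (hu : IsUnit (Nat.card Z : O))
    (hcomm : ∀ x y : G, π (x * y * x⁻¹ * y⁻¹) ∈ Z.map π) :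
    HasAbelianInertialQuotient (charIdempotent O Z φ) π.ker := by
  refine ⟨_, isBrauerPair_charIdempotent φ π hN hC hZ hu, fun x _ y _ => ?_⟩
  obtain ⟨z, hz, hzxy⟩ := hcomm x y
  have hker : x * y * x⁻¹ * y⁻¹ * z⁻¹ ∈ π.ker := by
    rw [MonoidHom.mem_ker, map_mul, ← hzxy, ← map_mul, mul_inv_cancel, map_one]
  rw [← inv_mul_cancel_right (x * y * x⁻¹ * y⁻¹) z]
  exact Subgroup.mul_mem_sup hker (Subgroup.center_le_centralizer _ (hZ hz))

end Block

/-! ### Sums over cosets with arbitrary representatives -/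

section Cosets

variable {H A : Type*} [Group H] [AddCommMonoid A] {Q : Subgroup H} {F : H → A}

theorem apply_out_eq (hF : ∀ h, ∀ q ∈ Q, F (h * q) = F h) (h : H) : F (h : H ⧸ Q).out = F h := by
  obtain ⟨q, hq⟩ := QuotientGroup.mk_out_eq_mul Q h
  rw [hq, hF h q q.2]

theorem sum_quotient_mul_left [Fintype (H ⧸ Q)] (hF : ∀ h, ∀ q ∈ Q, F (h * q) = F h) (g : H) :
    ∑ x : H ⧸ Q, F (g * x.out) = ∑ x : H ⧸ Q, F x.out := by
  refine Fintype.sum_equiv (MulAction.toPerm g) _ _ fun x => ?_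
  rw [← apply_out_eq hF (g * x.out)]
  congr 2
  rw [MulAction.toPerm_apply, ← MulAction.Quotient.coe_smul_out, smul_eq_mul]

theorem sum_eq_card_smul_sum_quotient [Fintype H] [Fintype (H ⧸ Q)]
    (hF : ∀ h, ∀ q ∈ Q, F (h * q) = F h) :
    ∑ h, F h = Nat.card Q • ∑ x : H ⧸ Q, F x.out := by
  classical
  rw [← Finset.sum_fiberwise Finset.univ (QuotientGroup.mk : H → H ⧸ Q) F, Finset.smul_sum]
  refine Finset.sum_congr rfl fun x _ => ?_
  have hconst : ∀ h ∈ Finset.univ.filter (fun h : H => (h : H ⧸ Q) = x), F h = F x.out := by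
    intro h hh
    rw [← (Finset.mem_filter.1 hh).2, apply_out_eq hF]
  rw [Finset.sum_congr rfl hconst, Finset.sum_const]
  congr 1
  have h1 := QuotientGroup.card_preimage_mk Q {x}
  rw [show Nat.card ({x} : Set (H ⧸ Q)) = 1 from Nat.card_unique, mul_one,
    Nat.card_eq_fintype_card, ← Set.toFinset_card] at h1
  rw [← h1]
  congr 1
  ext h
  simp

end Cosets

/-! ### Relative projectivity and Higman's criterion -/

section Higman

open Representation

variable {O H M : Type*} [CommRing O] [Group H] [AddCommGroup M] [Module O M]
    {ρ : Representation O H M} {Q : Subgroup H}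

/-- Induction is defined by coinvariants under h ↦ q h, so its components belong to the cosets Q h.
They are indexed below by the left cosets h⁻¹ Q, whence the inverses. -/
theorem indVmk_subgroup_mul (h : H) {q : H} (hq : q ∈ Q) (m : M) :
    IndV.mk Q.subtype (ρ.comp Q.subtype) (q * h) (ρ q m) =
      IndV.mk Q.subtype (ρ.comp Q.subtype) h m := by
  have h1 := Coinvariants.mk_self_apply
    (Representation.tprod ((leftRegular O H).comp Q.subtype) (ρ.comp Q.subtype)) ⟨q, hq⟩
    (single h 1 ⊗ₜ[O] m)
  simpa using h1

variable (ρ Q) in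
/-- The counit of induction and restriction. -/
noncomputable def indCounit : (ind Q.subtype (ρ.comp Q.subtype)).IntertwiningMap ρ where
  toLinearMap := Coinvariants.lift _
    (TensorProduct.lift <| (Finsupp.lift _ _ _ fun h => ρ h⁻¹) ∘ₗ
      (MonoidAlgebra.coeffLinearEquiv O).toLinearMap)
    fun g ↦ by
      ext h x
      simp
  isIntertwining' g := by
    ext
    simp

theorem indCounit_mk (h : H) (m : M) :
    indCounit ρ Q (IndV.mk Q.subtype (ρ.comp Q.subtype) h m) = ρ h⁻¹ m := by
  change TensorProduct.lift ((Finsupp.lift _ _ _ fun h => ρ h⁻¹) ∘ₗ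
      (MonoidAlgebra.coeffLinearEquiv O).toLinearMap) (single h 1 ⊗ₜ[O] m) = _
  simp

/-- Higman's criterion: `ρ` is relatively `Q`-projective if the identity is the relative trace of
an endomorphism that commutes with `Q`. -/
theorem isRelProjective_of_trace [Finite H] (θ : M →ₗ[O] M)
    (hθ : ∀ q ∈ Q, ∀ m, θ (ρ q m) = ρ q (θ m))
    (htr : ∀ m, ∑ᶠ x : H ⧸ Q, ρ x.out (θ (ρ x.out⁻¹ m)) = m) : IsRelProjective ρ Q := by
  have := Fintype.ofFinite (H ⧸ Q)
  -- The summand of the relative trace, kept in its own component of the induced module. It depends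
  -- only on the coset of h; the sum over cosets is H-equivariant, and composing it with the counit
  -- gives the trace of θ, the identity.
  let Γ : H → M →ₗ[O] IndV Q.subtype (ρ.comp Q.subtype) := fun h =>
    IndV.mk Q.subtype (ρ.comp Q.subtype) h⁻¹ ∘ₗ θ ∘ₗ ρ h⁻¹
  have hΓ : ∀ h, ∀ q ∈ Q, Γ (h * q) = Γ h := fun h q hq => by
    refine LinearMap.ext fun m => ?_
    have hq' := Q.inv_mem hq
    change IndV.mk _ _ (h * q)⁻¹ (θ (ρ (h * q)⁻¹ m)) = IndV.mk _ _ h⁻¹ (θ (ρ h⁻¹ m))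
    rw [mul_inv_rev, map_mul, Module.End.mul_apply, hθ _ hq', indVmk_subgroup_mul _ hq']
  refine ⟨⟨∑ x : H ⧸ Q, Γ x.out, fun g => ?_⟩, indCounit ρ Q, fun m => ?_⟩
  · refine LinearMap.ext fun m => ?_
    change (∑ x : H ⧸ Q, Γ x.out) (ρ g m) =
      ind Q.subtype (ρ.comp Q.subtype) g ((∑ x : H ⧸ Q, Γ x.out) m)
    conv_lhs => rw [← sum_quotient_mul_left hΓ g]
    rw [LinearMap.sum_apply, LinearMap.sum_apply, map_sum]
    refine Finset.sum_congr rfl fun x _ => ?_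
    change IndV.mk _ _ (g * x.out)⁻¹ (θ (ρ (g * x.out)⁻¹ (ρ g m))) =
      ind Q.subtype (ρ.comp Q.subtype) g (IndV.mk _ _ x.out⁻¹ (θ (ρ x.out⁻¹ m)))
    have h1 : ρ (x.out⁻¹ * g⁻¹) (ρ g m) = ρ x.out⁻¹ m := by
      rw [← Module.End.mul_apply, ← map_mul, inv_mul_cancel_right]
    rw [ind_mk, mul_inv_rev, h1]
  · change indCounit ρ Q ((∑ x : H ⧸ Q, Γ x.out) m) = m
    rw [LinearMap.sum_apply, map_sum]
    refine Eq.trans ?_ (htr m)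
    rw [finsum_eq_sum_of_fintype]
    refine Finset.sum_congr rfl fun x _ => ?_
    change indCounit ρ Q (IndV.mk _ _ x.out⁻¹ _) = _
    rw [indCounit_mk, inv_inv]
    rfl

open Classical in
variable (ρ Q) in
/-- The projection of an induced representation onto the component that belongs to a coset. -/
noncomputable def indComponent (x : H ⧸ Q) :
    IndV Q.subtype (ρ.comp Q.subtype) →ₗ[O] IndV Q.subtype (ρ.comp Q.subtype) :=
  Coinvariants.lift _
    (TensorProduct.lift <| (Finsupp.lift _ _ _ fun h =>
      if ((h⁻¹ : H) : H ⧸ Q) = x then IndV.mk Q.subtype (ρ.comp Q.subtype) h else 0) ∘ₗ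
      (MonoidAlgebra.coeffLinearEquiv O).toLinearMap)
    fun q ↦ by
      ext h m
      have h1 : ((((q : H) * h)⁻¹ : H) : H ⧸ Q) = (h⁻¹ : H) := by
        rw [mul_inv_rev]
        exact QuotientGroup.mk_mul_of_mem _ (Q.inv_mem q.2)
      by_cases hx : ((h⁻¹ : H) : H ⧸ Q) = x
      · have h2 := indVmk_subgroup_mul (ρ := ρ) h q.2 m
        simpa [hx, h1, -mul_inv_rev] using h2
      · simp [hx, h1, -mul_inv_rev]

open Classical in
theorem indComponent_mk (x : H ⧸ Q) (h : H) (m : M) :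
    indComponent ρ Q x (IndV.mk Q.subtype (ρ.comp Q.subtype) h m) =
      if ((h⁻¹ : H) : H ⧸ Q) = x then IndV.mk Q.subtype (ρ.comp Q.subtype) h m else 0 := by
  change TensorProduct.lift ((Finsupp.lift _ _ _ fun h =>
      if ((h⁻¹ : H) : H ⧸ Q) = x then IndV.mk Q.subtype (ρ.comp Q.subtype) h else 0) ∘ₗ
      (MonoidAlgebra.coeffLinearEquiv O).toLinearMap) (single h 1 ⊗ₜ[O] m) = _
  split_ifs with hx <;> simp [hx]

theorem sum_indComponent [Fintype (H ⧸ Q)] : ∑ x, indComponent ρ Q x = LinearMap.id := by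
  classical
  refine IndV.hom_ext _ _ fun h => LinearMap.ext fun m => ?_
  rw [LinearMap.comp_apply, LinearMap.sum_apply, Finset.sum_congr rfl fun x _ =>
    indComponent_mk x h m]
  simp

theorem indComponent_smul (g : H) (x : H ⧸ Q) (n : IndV Q.subtype (ρ.comp Q.subtype)) :
    indComponent ρ Q (g • x) (ind Q.subtype (ρ.comp Q.subtype) g n) =
      ind Q.subtype (ρ.comp Q.subtype) g (indComponent ρ Q x n) := by
  classical
  suffices h : indComponent ρ Q (g • x) ∘ₗ ind Q.subtype (ρ.comp Q.subtype) g =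
      ind Q.subtype (ρ.comp Q.subtype) g ∘ₗ indComponent ρ Q x from LinearMap.congr_fun h n
  refine IndV.hom_ext _ _ fun h => LinearMap.ext fun m => ?_
  change indComponent ρ Q (g • x) (ind Q.subtype (ρ.comp Q.subtype) g (IndV.mk _ _ h m)) =
    ind Q.subtype (ρ.comp Q.subtype) g (indComponent ρ Q x (IndV.mk _ _ h m))
  rw [ind_mk, indComponent_mk, indComponent_mk]
  have h1 : (((h * g⁻¹)⁻¹ : H) : H ⧸ Q) = g • ((h⁻¹ : H) : H ⧸ Q) := by
    rw [mul_inv_rev, inv_inv]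
    rfl
  by_cases hx : ((h⁻¹ : H) : H ⧸ Q) = x
  · rw [if_pos (by rw [h1, hx]), if_pos hx, ind_mk]
  · rw [if_neg (by rwa [h1, smul_left_cancel_iff]), if_neg hx, map_zero]

/-- The coset projections of the induced module, placed between the inclusion and the retraction,
decompose the identity into maps that H permutes as it permutes the cosets. This form of the
converse of Higman's criterion suits the counting of orbits modulo p. -/
theorem IsRelProjective.exists_components [Finite H] (hρ : IsRelProjective ρ Q) :
    ∃ F : H ⧸ Q → M →ₗ[O] M, (∀ m, ∑ᶠ x, F x m = m) ∧
      ∀ g x m, F (g • x) (ρ g m) = ρ g (F x m) := by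
  have := Fintype.ofFinite (H ⧸ Q)
  obtain ⟨i, π, hπ⟩ := hρ
  refine ⟨fun x => π.toLinearMap ∘ₗ indComponent ρ Q x ∘ₗ i.toLinearMap, fun m => ?_,
    fun g x m => ?_⟩
  · rw [finsum_eq_sum_of_fintype]
    change ∑ x, π.toLinearMap (indComponent ρ Q x (i m)) = m
    rw [← map_sum, ← LinearMap.sum_apply, sum_indComponent]
    exact hπ m
  · change π (indComponent ρ Q (g • x) (i (ρ g m))) = ρ g (π (indComponent ρ Q x (i m)))
    rw [i.isIntertwining, indComponent_smul, π.isIntertwining]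

/-- If a `P`-fixed vector is not killed by a `P`-invariant functional with values in characteristic
`p`, then the representation is not relatively projective for proper subgroups of `P`. -/
theorem IsRelProjective.eq_of_le {p : ℕ} [Fact p.Prime] {k : Type*} [Ring k] [CharP k p] [Finite H]
    (hρ : IsRelProjective ρ Q) {P : Subgroup H} (hP : IsPGroup p P) (hQ : Q ≤ P) (t : M →+ k)
    (ht : ∀ d ∈ P, ∀ m, t (ρ d m) = t m) {m : M} (hm : ∀ d ∈ P, ρ d m = m) (hne : t m ≠ 0) :
    Q = P := by
  have := Fintype.ofFinite (H ⧸ Q)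
  by_contra hQP
  obtain ⟨F, hsum, hF⟩ := hρ.exists_components
  refine hne ?_
  rw [← hsum m, finsum_eq_sum_of_fintype, map_sum]
  -- As m is fixed by P and t is P-invariant, x ↦ t (F x m) is constant on the P-orbits of cosets.
  refine sum_eq_zero_of_isPGroup hP (fun x => t (F x m)) (fun d x => ?_) fun x => ?_
  · have h1 := hF d x m
    rw [hm d d.2] at h1
    change t (F ((d : H) • x) m) = t (F x m)
    rw [h1, ht d d.2]
  -- If P fixed the coset y Q, then y⁻¹ P y would lie in Q, which forces |P| ≤ |Q|.
  · by_contra! h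
    obtain ⟨y, rfl⟩ := QuotientGroup.mk_surjective x
    have hmem : ∀ d : P, y⁻¹ * d * y ∈ Q := fun d => by
      have h1 : ((y : H) : H ⧸ Q) = ((d * y : H) : H ⧸ Q) := (h d).symm
      rw [QuotientGroup.eq, ← mul_assoc] at h1
      exact h1
    refine hQP (Subgroup.eq_of_le_of_card_ge hQ ?_)
    refine Nat.card_le_card_of_injective (fun d : P => (⟨y⁻¹ * d * y, hmem d⟩ : Q)) ?_
    intro d d' hd
    have h2 : y⁻¹ * (d : H) * y = y⁻¹ * d' * y := congrArg Subtype.val hd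
    exact Subtype.ext (mul_left_cancel (mul_right_cancel h2))

end Higman

/-! ### Bimodules twisted by an endomorphism -/

section Twist

variable {O : Type u} [CommRing O] {A : Type u} [Ring A] [Algebra O A]

/-- `A_α ⊗_A V` is the twist of `V` by `α`, where `A_α` is the regular bimodule with its left action
twisted by `α`. -/
noncomputable def twistEquiv (α : A →ₐ[O] A) (V : Type u) [AddCommGroup V] [Module O V] [Module A V]
    [IsScalarTower O A V] : BTensor O A (Twisted α A) V ≃ₗ[A] Twisted α V :=
  upgrade (O := O) (LinearEquiv.ofLinearMap
    (BTensor.lift (LinearMap.mk₂ O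
      (fun (m : Twisted α A) (v : V) => toTwisted α V ((toTwisted α A).symm m • v))
      (fun m m' v => add_smul ((toTwisted α A).symm m) ((toTwisted α A).symm m') v)
      (fun c m v => smul_assoc c ((toTwisted α A).symm m) v)
      (fun m v v' => smul_add ((toTwisted α A).symm m) v v')
      (fun c m v => smul_algebra_smul_comm c ((toTwisted α A).symm m) v))
      (fun m a v => mul_smul ((toTwisted α A).symm m) a v))
    (((BTensor.mk : Twisted α A →ₗ[O] V →ₗ[O] BTensor O A (Twisted α A) V)
      (toTwisted α A 1)))
    (LinearMap.ext fun v => one_smul A ((toTwisted α V).symm v))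
    (BTensor.hom_ext fun m v => by
      have h := BTensor.mk_op_smul (O := O) (V := V) (toTwisted α A (1 : A))
        ((toTwisted α A).symm m) v
      have h1 : MulOpposite.op ((toTwisted α A).symm m) • toTwisted α A (1 : A) = m :=
        one_mul ((toTwisted α A).symm m)
      rw [h1] at h
      exact h.symm))
    (fun a x => by
      induction x using BTensor.induction with
      | h0 => simp
      | h m v => exact mul_smul (α a) ((toTwisted α A).symm m) v
      | hadd x y hx hy => simp_all)

theorem inducesTwist_twist (α : A →ₐ[O] A) : (BimoduleOver.twist α).InducesTwist α :=
  ⟨fun V _ _ _ _ => twistEquiv α V, fun _ _ _ _ _ _ _ _ _ _ g m v =>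
    (map_smul g ((toTwisted α A).symm m) v).symm⟩

/-- Tensoring with the first bimodule twists the second one by α, so that a acts through β (α a) =
a, while the right action is untouched. -/
theorem twist_tensor_twist (α β : A →ₐ[O] A) (h : ∀ a, β (α a) = a) :
    ((BimoduleOver.twist α).tensor (BimoduleOver.twist β)).IsIso (BimoduleOver.regular O A) := by
  refine ⟨(twistEquiv α (Twisted β A)).trans
    { toFun := fun v => (toTwisted β A).symm ((toTwisted α _).symm v)
      invFun := fun v => toTwisted α _ (toTwisted β A v)
      map_add' := fun _ _ => rfl
      map_smul' := fun a v => congrArg (· * (toTwisted β A).symm ((toTwisted α _).symm v)) (h a)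
      left_inv := fun _ => rfl
      right_inv := fun _ => rfl }, fun a x => ?_⟩
  induction x using BTensor.induction with
  | h0 => simp
  | h m v =>
    exact (mul_assoc (β ((toTwisted α A).symm m)) ((toTwisted β A).symm v) a).symm
  | hadd x y hx hy => rw [smul_add, map_add, hx, hy, map_add, smul_add]

/-- The class of the bimodule twisted by an automorphism as an element of the Picard group. -/
noncomputable def twistUnit (α β : A →ₐ[O] A) (h : ∀ a, β (α a) = a) (h' : ∀ a, α (β a) = a) :
    Pic O A where
  val := (BimoduleOver.twist α).cls
  inv := (BimoduleOver.twist β).cls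
  val_inv := Quotient.sound (twist_tensor_twist α β h)
  inv_val := Quotient.sound (twist_tensor_twist β α h')

/-- If the bimodule twisted by `α` is isomorphic to the regular bimodule, then `α` is inner. -/
theorem exists_of_twist_isIso_regular {α : A →ₐ[O] A}
    (h : (BimoduleOver.twist α).IsIso (BimoduleOver.regular O A)) :
    ∃ u v : A, u * v = 1 ∧ ∀ a, u * α a = a * u := by
  obtain ⟨f, hf⟩ := h
  -- By right linearity `f` is left multiplication by `f 1`; left linearity then becomes the
  -- relation between α and this element.
  have hmul : ∀ a : A, f (toTwisted α A a) = f (toTwisted α A 1) * a := fun a => by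
    have h1 := hf a (toTwisted α A 1)
    have h2 : MulOpposite.op a • toTwisted α A (1 : A) = toTwisted α A a := one_mul a
    rw [h2] at h1
    exact h1
  refine ⟨f (toTwisted α A 1), (toTwisted α A).symm (f.symm 1), ?_, fun a => ?_⟩
  · rw [← hmul]
    exact f.apply_symm_apply 1
  · rw [← hmul]
    have h1 := f.map_smul a (toTwisted α A 1)
    rw [twisted_smul, smul_eq_mul, mul_one] at h1
    exact h1

/-- Schur's lemma: kernel and range of T are stable under A, the range because α is surjective, so a
nonzero T is bijective. -/
theorem fixesIrr_twist (K : Type u) [Field K] [Algebra O K] (α : A →ₐ[O] A)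
    (hα : Function.Surjective α)
    (hT : ∀ (V : Type u) [AddCommGroup V] [Module O V] [Module A V] [Module K V]
      [IsScalarTower O A V] [IsScalarTower O K V] [SMulCommClass K A V], IsSimpleOver K A V →
      ∃ T : V →ₗ[K] V, T ≠ 0 ∧ ∀ (a : A) v, T (a • v) = α a • T v) :
    (BimoduleOver.twist α).FixesIrr K := by
  intro V _ _ _ _ _ _ _ hV
  obtain ⟨T, hT0, hTa⟩ := hT V hV
  have hinj : Function.Injective T := by
    rw [← LinearMap.ker_eq_bot]
    refine (hV.2 (LinearMap.ker T) fun a w hw => ?_).resolve_right fun h =>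
      hT0 (LinearMap.ker_eq_top.1 h)
    rw [LinearMap.mem_ker] at hw ⊢
    rw [hTa, hw, smul_zero]
  have hsurj : Function.Surjective T := by
    rw [← LinearMap.range_eq_top]
    refine (hV.2 (LinearMap.range T) fun a w hw => ?_).resolve_left fun h =>
      hT0 (LinearMap.range_eq_bot.1 h)
    obtain ⟨v, rfl⟩ := hw
    obtain ⟨b, rfl⟩ := hα a
    exact ⟨b • v, hTa b v⟩
  let f : V →ₗ[A] Twisted α V :=
    { toFun := fun v => toTwisted α V (T v)
      map_add' := fun v w => map_add T v w
      map_smul' := fun a v => by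
        rw [hTa]
        rfl }
  exact ⟨(twistEquiv α V).trans (LinearEquiv.ofBijective f ⟨hinj, hsurj⟩).symm⟩

end Twist

/-! ### Elements of the block algebra -/

section BlockAlgebra

variable {O : Type u} [CommRing O] {G : Type} [Group G] {e : MonoidAlgebra O G}
  (he : IsBlockIdempotent e)
include he

theorem IsBlockIdempotent.val_mul (x : he.Alg) : x.1 * e = x.1 := by
  obtain ⟨r, hr⟩ := x.2
  rw [← hr, mul_assoc, he.idem]

theorem IsBlockIdempotent.mul_val (x : he.Alg) : e * x.1 = x.1 := by
  rw [he.central, he.val_mul]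

theorem IsBlockIdempotent.of_val (g : G) : (he.of g).1 = single g 1 * e := by
  change e * single g 1 * e = _
  rw [he.central, mul_assoc, he.idem]

theorem IsBlockIdempotent.mul_of_val (x : he.Alg) (g : G) : (x * he.of g).1 = x.1 * single g 1 := by
  change x.1 * (he.of g).1 = _
  rw [he.of_val, ← he.central, ← mul_assoc, he.val_mul]

theorem IsBlockIdempotent.of_mul_val (x : he.Alg) (g : G) : (he.of g * x).1 = single g 1 * x.1 := by
  change (he.of g).1 * x.1 = _
  rw [he.of_val, mul_assoc, he.mul_val]

theorem IsBlockIdempotent.eq_sum_of [Fintype G] (x : he.Alg) :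
    x = ∑ g : G, x.1.coeff g • he.of g := by
  refine Subtype.ext ?_
  have hsum : ∀ s : Finset G, (∑ g ∈ s, x.1.coeff g • he.of g : he.Alg).1 =
      ∑ g ∈ s, single g (x.1.coeff g) * e := fun s => by
    classical
    induction s using Finset.induction_on with
    | empty => rfl
    | insert a s ha ih =>
      rw [Finset.sum_insert ha, Finset.sum_insert ha, ← ih]
      change x.1.coeff a • (he.of a).1 + _ = _
      rw [he.of_val, ← smul_mul_assoc, MonoidAlgebra.smul_single, smul_eq_mul, mul_one]
  rw [hsum, ← Finset.sum_mul, ← he.val_mul x]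
  congr 1
  rw [he.val_mul]
  conv_lhs => rw [← MonoidAlgebra.sum_coeff_single x.1]
  rw [Finsupp.sum_fintype _ _ (by simp)]

theorem IsBlockIdempotent.alg_induction [Finite G] {P : he.Alg → Prop}
    (hof : ∀ g, P (he.of g)) (hadd : ∀ x y, P x → P y → P (x + y))
    (hsmul : ∀ (c : O) x, P x → P (c • x)) (x : he.Alg) : P x := by
  have := Fintype.ofFinite G
  rw [he.eq_sum_of x]
  refine Finset.sum_induction _ P hadd ?_ fun g _ => hsmul _ _ (hof g)
  have h := hsmul 0 _ (hof 1)
  rwa [zero_smul] at h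

end BlockAlgebra

/-! ### The bimodule M_λ: indecomposability and vertex -/

section Tensoring

variable {O : Type u} [CommRing O] [IsDomain O] [IsIntegrallyClosed O]
  {K : Type u} [Field K] [Algebra O K] [IsFractionRing O K]
  {G : Type} [Group G] [Finite G] {e : MonoidAlgebra O G}

theorem tensorChar_single (lam : G →* Kˣ) (g : G) (r : O) :
    tensorChar O lam (single g r) = single g (r * (integralChar O lam g : O)) := by
  simp [tensorChar]

theorem tensorChar_inv_apply (lam mu : G →* Kˣ) (h : ∀ g, lam g * mu g = 1)
    (a : MonoidAlgebra O G) : tensorChar O lam (tensorChar O mu a) = a := by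
  have h1 : ∀ g, (integralChar O mu g : O) * (integralChar O lam g : O) = 1 := fun g => by
    apply IsFractionRing.injective O K
    rw [map_mul, algebraMap_integralChar, algebraMap_integralChar, map_one, ← Units.val_mul,
      mul_comm, h, Units.val_one]
  induction a using MonoidAlgebra.induction_linear with
  | zero => simp
  | add a b ha hb => rw [map_add, map_add, ha, hb]
  | single x r => rw [tensorChar_single, tensorChar_single, mul_assoc, h1, mul_one]

theorem integralChar_eq_one {H : Type*} [Group H] [Finite H] {lam : H →* Kˣ} {x : H}
    (h : lam x = 1) : integralChar O lam x = 1 := by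
  refine Units.ext (IsFractionRing.injective O K ?_)
  rw [algebraMap_integralChar, h]
  simp

theorem tensorChar_charIdempotent {Z : Subgroup G} (φ : Z →* Kˣ) {lam : G →* Kˣ}
    (h : Z ≤ lam.ker) : tensorChar O lam (charIdempotent O Z φ) = charIdempotent O Z φ := by
  have := Fintype.ofFinite Z
  rw [charIdempotent_eq_sum, map_smul, map_sum]
  congr 1
  refine Finset.sum_congr rfl fun z _ => ?_
  rw [tensorChar_single, integralChar_eq_one (h z.2), Units.val_one, mul_one]

variable (he : IsBlockIdempotent e) {lam : G →* Kˣ} (h : tensorChar O lam e = e)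
include he h

theorem IsBlockIdempotent.tensorEnd_of (g : G) :
    he.tensorEnd lam h (he.of g) = (integralChar O lam g : O) • he.of g := by
  refine Subtype.ext ?_
  change tensorChar O lam (he.of g).1 = (integralChar O lam g : O) • (he.of g).1
  rw [he.of_val, map_mul, h, tensorChar_single, ← smul_mul_assoc, MonoidAlgebra.smul_single,
    smul_eq_mul, mul_one, one_mul]

theorem IsBlockIdempotent.tensorEnd_tensorEnd {mu : G →* Kˣ} (h' : tensorChar O mu e = e)
    (hmu : ∀ g, lam g * mu g = 1) (a : he.Alg) :
    he.tensorEnd lam h (he.tensorEnd mu h' a) = a :=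
  Subtype.ext (tensorChar_inv_apply lam mu hmu a.1)

/-- The element of the group algebra that underlies an element of the twisted block algebra. -/
noncomputable def IsBlockIdempotent.twistVal (m : (he.tensorBimod lam h).carrier) :
    MonoidAlgebra O G :=
  ((toTwisted (he.tensorEnd lam h) he.Alg).symm m).1

theorem IsBlockIdempotent.rep_val (x y : G) (m : (he.tensorBimod lam h).carrier) :
    he.twistVal h (he.rep (he.tensorBimod lam h) (x, y) m) =
      (integralChar O lam x : O) • (single x 1 * he.twistVal h m * single y⁻¹ 1) := by
  set m' := (toTwisted (he.tensorEnd lam h) he.Alg).symm m with hm'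
  change (he.tensorEnd lam h (he.of x) * (m' * he.of y⁻¹)).1 = _
  rw [he.tensorEnd_of, smul_mul_assoc]
  change (integralChar O lam x : O) • (he.of x * (m' * he.of y⁻¹)).1 = _
  rw [he.of_mul_val, he.mul_of_val, ← mul_assoc]
  rfl

/-- An endomorphism is right linear, hence left multiplication by the image of 1. On the left the
scalars λ(g) cancel, so this image is central; for an idempotent endomorphism it is a central
idempotent below the block idempotent. -/
theorem IsBlockIdempotent.indecomposable_tensorBimod
    (f : (he.rep (he.tensorBimod lam h)).IntertwiningMap (he.rep (he.tensorBimod lam h)))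
    (hf : ∀ m, f (f m) = f m) : (∀ m, f m = 0) ∨ ∀ m, f m = m := by
  let F : he.Alg →ₗ[O] he.Alg := f.toLinearMap
  have hF : ∀ (x y : G) (m : he.Alg), F (he.tensorEnd lam h (he.of x) * (m * he.of y⁻¹)) =
      he.tensorEnd lam h (he.of x) * (F m * he.of y⁻¹) := fun x y m =>
    Representation.IntertwiningMap.isIntertwining _ _ f (x, y) m
  have hright : ∀ m a : he.Alg, F (m * a) = F m * a := fun m a => by
    induction a using he.alg_induction with
    | hof g =>
      have h1 := hF 1 g⁻¹ m
      rwa [map_one, map_one, one_mul, one_mul, inv_inv] at h1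
    | hadd x y hx hy => rw [mul_add, map_add, hx, hy, mul_add]
    | hsmul c x hx => rw [mul_smul_comm, map_smul, hx, mul_smul_comm]
  have hFm : ∀ m, F m = F 1 * m := fun m => by rw [← hright, one_mul]
  have hcomm : ∀ g, he.of g * F 1 = F 1 * he.of g := fun g => by
    have h1 := hF g 1 1
    rw [inv_one, map_one, mul_one, mul_one, mul_one, he.tensorEnd_of, map_smul, hFm,
      smul_mul_assoc] at h1
    exact ((Units.isUnit _).smul_left_cancel.1 h1).symm
  have hid : F 1 * F 1 = F 1 := by
    rw [← hFm]
    exact hf _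
  have hcen : ∀ g : G, single g 1 * (F 1).1 = (F 1).1 * single g 1 := fun g => by
    rw [← he.of_mul_val, ← he.mul_of_val, hcomm]
  rcases he.primitive (F 1).1 (congrArg Subtype.val hid) (central_of_forall_single hcen)
    (he.val_mul _) with h0 | h1
  · left
    intro m
    have h2 : F 1 = 0 := Subtype.ext h0
    have h3 : ∀ a : he.Alg, F a = 0 := fun a => by rw [hFm, h2, zero_mul]
    exact h3 m
  · right
    intro m
    have h2 : F 1 = 1 := Subtype.ext h1
    have h3 : ∀ a : he.Alg, F a = a := fun a => by rw [hFm, h2, one_mul]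
    exact h3 m

theorem IsBlockIdempotent.twistVal_injective : Function.Injective (he.twistVal h) :=
  Subtype.val_injective

/-- The coefficient of `1`, as a functional on the twisted block algebra. -/
noncomputable def IsBlockIdempotent.coeffOne : (he.tensorBimod lam h).carrier →ₗ[O] O where
  toFun m := (he.twistVal h m).coeff 1
  map_add' _ _ := rfl
  map_smul' _ _ := rfl

theorem IsBlockIdempotent.coeffOne_rep (x y : G) (m : (he.tensorBimod lam h).carrier) :
    he.coeffOne h (he.rep (he.tensorBimod lam h) (x, y) m) =
      integralChar O lam x * (he.twistVal h m).coeff (x⁻¹ * y) := by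
  change (he.twistVal h (he.rep _ (x, y) m)).coeff 1 = _
  rw [he.rep_val h, MonoidAlgebra.coeff_smul_apply, MonoidAlgebra.coeff_mul_single_apply,
    MonoidAlgebra.coeff_single_mul_apply, smul_eq_mul]
  simp

variable {N : Subgroup G} (hlam : ∀ d ∈ N, lam d = 1)
include hlam

theorem IsBlockIdempotent.coeffOne_rep_diagonal {d : G} (hd : d ∈ N)
    (m : (he.tensorBimod lam h).carrier) :
    he.coeffOne h (he.rep (he.tensorBimod lam h) (d, d) m) = he.coeffOne h m := by
  rw [he.coeffOne_rep h, integralChar_eq_one (hlam d hd), inv_mul_cancel, Units.val_one, one_mul]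
  rfl

theorem IsBlockIdempotent.rep_diagonal_one {d : G} (hd : d ∈ N) :
    he.rep (he.tensorBimod lam h) (d, d) (toTwisted (he.tensorEnd lam h) he.Alg 1) =
      toTwisted (he.tensorEnd lam h) he.Alg 1 := by
  apply he.twistVal_injective h
  have h1 : he.twistVal h (toTwisted (he.tensorEnd lam h) he.Alg 1) = e := rfl
  rw [he.rep_val h, h1, integralChar_eq_one (hlam d hd), Units.val_one, one_smul, ← he.central,
    mul_assoc, MonoidAlgebra.single_mul_single, mul_inv_cancel, one_mul, ← MonoidAlgebra.one_def,
    mul_one]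

/-- Higman's criterion for θ(m) = |G : N|⁻¹ m₁ · 1, where m₁ is the coefficient of m at the
identity. For a pair (x, y) the factors λ(x⁻¹) and λ(x) cancel, and what remains is |G : N|⁻¹ times
the component of m at x y⁻¹, multiplied by e. -/
theorem IsBlockIdempotent.isRelProjective_tensorBimod [CharZero O] (hi : IsUnit (N.index : O)) :
    IsRelProjective (he.rep (he.tensorBimod lam h))
      (N.map ((MonoidHom.id G).prod (MonoidHom.id G))) := by
  classical
  set ρ := he.rep (he.tensorBimod lam h) with hρ
  set Δ := N.map ((MonoidHom.id G).prod (MonoidHom.id G)) with hΔ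
  let one' := toTwisted (he.tensorEnd lam h) he.Alg 1
  let j : O := Ring.inverse (N.index : O)
  let θ : (he.tensorBimod lam h).carrier →ₗ[O] (he.tensorBimod lam h).carrier :=
    (he.coeffOne h).smulRight (j • one')
  have hθ' : ∀ m, θ m = he.coeffOne h m • j • one' := fun m => rfl
  have hθ : ∀ q ∈ Δ, ∀ m, θ (ρ q m) = ρ q (θ m) := by
    rintro _ ⟨d, hd, rfl⟩ m
    change θ (ρ (d, d) m) = ρ (d, d) (θ m)
    rw [hθ', hθ', he.coeffOne_rep_diagonal h hlam hd, map_smul, map_smul,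
      he.rep_diagonal_one h hlam hd]
  refine isRelProjective_of_trace θ hθ fun m => ?_
  have := Fintype.ofFinite G
  have := Fintype.ofFinite ((G × G) ⧸ Δ)
  rw [finsum_eq_sum_of_fintype]
  -- The summand depends only on the coset, so |Δ| times the trace is a sum over all of G × G, where
  -- no representatives intervene.
  have hF : ∀ g : G × G, ∀ q ∈ Δ, ρ (g * q) (θ (ρ (g * q)⁻¹ m)) = ρ g (θ (ρ g⁻¹ m)) := by
    intro g q hq
    rw [mul_inv_rev, map_mul, map_mul, Module.End.mul_apply, Module.End.mul_apply,
      hθ _ (Δ.inv_mem hq), ← Module.End.mul_apply (ρ q), ← map_mul, mul_inv_cancel, map_one,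
      Module.End.one_apply]
  have hsum := sum_eq_card_smul_sum_quotient (F := fun g : G × G => ρ g (θ (ρ g⁻¹ m))) hF
  have hval : ∀ x y : G, he.twistVal h (ρ (x, y) (θ (ρ (x, y)⁻¹ m))) =
      j • (single (x * y⁻¹) ((he.twistVal h m).coeff (x * y⁻¹)) * e) := fun x y => by
    have h1 : he.twistVal h one' = e := rfl
    have h2 : he.coeffOne h (ρ (x, y)⁻¹ m) = (integralChar O lam x⁻¹ : O) *
        (he.twistVal h m).coeff (x * y⁻¹) := by
      have h3 := he.coeffOne_rep h x⁻¹ y⁻¹ m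
      rwa [inv_inv] at h3
    have h4 : he.twistVal h (ρ (x, y) one') = (integralChar O lam x : O) •
        (single (x * y⁻¹) 1 * e) := by
      rw [he.rep_val h, h1, mul_assoc, he.central, ← mul_assoc, MonoidAlgebra.single_mul_single,
        one_mul]
    rw [hθ', map_smul, map_smul, h2]
    change ((integralChar O lam x⁻¹ : O) * (he.twistVal h m).coeff (x * y⁻¹)) • j •
      he.twistVal h (ρ (x, y) one') = _
    rw [h4, smul_comm _ j, smul_smul _ (integralChar O lam x : O), mul_right_comm, ← Units.val_mul,
      ← map_mul, inv_mul_cancel, map_one, Units.val_one, one_mul, ← smul_mul_assoc,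
      MonoidAlgebra.smul_single, smul_eq_mul, mul_one]
  have hadd : ∀ s : Finset (G × G), he.twistVal h (∑ g ∈ s, ρ g (θ (ρ g⁻¹ m))) =
      ∑ g ∈ s, he.twistVal h (ρ g (θ (ρ g⁻¹ m))) := fun s => by
    induction s using Finset.induction_on with
    | empty => rfl
    | insert a s ha ih =>
      rw [Finset.sum_insert ha, Finset.sum_insert ha, ← ih]
      rfl
  have hnsmul : ∀ (n : ℕ) (m : (he.tensorBimod lam h).carrier),
      he.twistVal h (n • m) = n • he.twistVal h m := fun n m => by
    rw [← Nat.cast_smul_eq_nsmul O, ← Nat.cast_smul_eq_nsmul O]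
    rfl
  have hcard : Nat.card Δ = Nat.card N :=
    Subgroup.card_map_of_injective fun a b hab => congrArg Prod.fst hab
  have hme : he.twistVal h m * e = he.twistVal h m := he.val_mul _
  -- For fixed y the product x y⁻¹ runs through G, and the components of m add up to m e = m.
  have hcol : ∀ y : G, ∑ x : G, he.twistVal h (ρ (x, y) (θ (ρ (x, y)⁻¹ m))) =
      j • he.twistVal h m := fun y => by
    simp only [hval]
    rw [Fintype.sum_equiv (Equiv.mulRight y⁻¹)
      (fun x => j • (single (x * y⁻¹) ((he.twistVal h m).coeff (x * y⁻¹)) * e))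
      (fun g => j • (single g ((he.twistVal h m).coeff g) * e)) fun x => rfl, ← Finset.smul_sum,
      ← Finset.sum_mul]
    conv_rhs => rw [← hme, ← MonoidAlgebra.sum_coeff_single (he.twistVal h m)]
    rw [Finsupp.sum_fintype _ _ (by simp)]
  have htotal : ∑ g : G × G, ρ g (θ (ρ g⁻¹ m)) = Nat.card Δ • m := by
    apply he.twistVal_injective h
    rw [hadd, Fintype.sum_prod_type_right, Finset.sum_congr rfl fun y _ => hcol y,
      Finset.sum_const, Finset.card_univ, ← Nat.card_eq_fintype_card, hnsmul, hcard,
      ← N.card_mul_index, mul_smul, ← Nat.cast_smul_eq_nsmul O N.index, smul_smul,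
      Ring.mul_inverse_cancel _ hi, one_smul]
  rw [htotal] at hsum
  apply he.twistVal_injective h
  have hsum' := congrArg (he.twistVal h) hsum
  rw [hnsmul, hnsmul] at hsum'
  ext x
  -- The factor |Δ| is cancelled coefficientwise, O being a domain of characteristic 0.
  have hx := congrArg (fun a => a.coeff x) hsum'
  simp only [MonoidAlgebra.coeff_smul_apply] at hx
  rw [nsmul_eq_mul, nsmul_eq_mul] at hx
  exact (mul_left_cancel₀ (Nat.cast_ne_zero.2 Nat.card_pos.ne') hx).symm

/-- The twisted block algebra is indecomposable with vertex the diagonal subgroup of `N`. -/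
theorem IsBlockIdempotent.hasVertex_tensorBimod [CharZero O] [IsLocalRing O] {p : ℕ} [Fact p.Prime]
    [CharP (IsLocalRing.ResidueField O) p] (hN : IsPGroup p N) (hi : IsUnit (N.index : O))
    (hone : IsUnit (e.coeff 1)) :
    HasVertex (he.rep (he.tensorBimod lam h))
      (N.map ((MonoidHom.id G).prod (MonoidHom.id G))) where
  nontrivial := ⟨toTwisted (he.tensorEnd lam h) he.Alg 1, 0, fun h1 =>
    he.ne_zero (congrArg (he.twistVal h) h1)⟩
  indecomposable := he.indecomposable_tensorBimod h
  relProjective := he.isRelProjective_tensorBimod h hlam hi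
  minimal Q hQ hrel := by
    -- The functional is the coefficient at the identity modulo the maximal ideal, and the fixed
    -- vector is 1 ∈ B, on which it takes the nonzero residue of `e.coeff 1`.
    refine hrel.eq_of_le (hN.map _) hQ
      ((IsLocalRing.residue O).toAddMonoidHom.comp (he.coeffOne h).toAddMonoidHom)
      ?_ (m := toTwisted (he.tensorEnd lam h) he.Alg 1) ?_ ?_
    · rintro _ ⟨d, hd, rfl⟩ m
      exact congrArg (IsLocalRing.residue O) (he.coeffOne_rep_diagonal h hlam hd m)
    · rintro _ ⟨d, hd, rfl⟩
      exact he.rep_diagonal_one h hlam hd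
    · exact (hone.map (IsLocalRing.residue O)).ne_zero

end Tensoring

/-- In (1 + r + ⋯ + r^(n-1)) (r - 1) = 0 the first factor reduces to n, so it is a unit. -/
theorem eq_one_of_residue_eq_one {O : Type*} [CommRing O] [IsLocalRing O] {r : O} {n : ℕ}
    (hr : r ^ n = 1) (hn : IsUnit (n : O)) (h : IsLocalRing.residue O r = 1) : r = 1 := by
  have h1 := geom_sum_mul r n
  rw [hr, sub_self] at h1
  have h2 : IsUnit (∑ i ∈ Finset.range n, r ^ i) := by
    rw [← IsLocalRing.residue_ne_zero_iff_isUnit, map_sum]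
    simp only [map_pow, h, one_pow, Finset.sum_const, Finset.card_range, nsmul_eq_mul, mul_one]
    rw [← map_natCast (IsLocalRing.residue O)]
    exact (IsLocalRing.residue_ne_zero_iff_isUnit _).2 hn
  exact sub_eq_zero.1 ((h2.mul_right_eq_zero).1 h1)

/-! ### M_λ is not isomorphic to B -/

section Nontrivial

variable {O : Type u} [CommRing O] [IsDomain O] [IsIntegrallyClosed O] [IsLocalRing O]
  [IsNoetherianRing O] {K : Type u} [Field K] [Algebra O K] [IsFractionRing O K]
  {G : Type} [Group G] [Finite G] {E : Type} [Group E] {Z : Subgroup G} {φ : Z →* Kˣ}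
  {p : ℕ} [Fact p.Prime] [CharP (IsLocalRing.ResidueField O) p]

/-- An isomorphism provides a unit u with x u = λ(x) u x. Since λ is trivial on ker π, u commutes
with ker π, so its reduction is c times that of the block idempotent. That image commutes with
everything coming from G, so the relation at g forces λ(g) ≡ 1. -/
theorem IsBlockIdempotent.not_tensorBimod_isIso_regular
    (he : IsBlockIdempotent (charIdempotent O Z φ)) (π : G →* E) (hN : IsPGroup p π.ker)
    (hC : ∀ x ∈ Subgroup.centralizer (π.ker : Set G), π x ∈ Z.map π)
    {lam : G →* Kˣ} (h : tensorChar O lam (charIdempotent O Z φ) = charIdempotent O Z φ)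
    (hlam : ∀ d ∈ π.ker, lam d = 1) {g : G}
    (hg : IsLocalRing.residue O (integralChar O lam g : O) ≠ 1) :
    ¬ (he.tensorBimod lam h).IsIso (BimoduleOver.regular O he.Alg) := by
  intro hiso
  obtain ⟨u, v, huv, hu⟩ := exists_of_twist_isIso_regular hiso
  have hcomm : ∀ x : G, single x 1 * u.1 = (integralChar O lam x : O) • (u.1 * single x 1) := by
    intro x
    have h1 := hu (he.of x)
    rw [he.tensorEnd_of, mul_smul_comm] at h1
    rw [← he.of_mul_val, ← h1, ← he.mul_of_val]
    rfl
  have hbar : reduction O π (charIdempotent O Z φ) ≠ 0 := fun h0 => he.ne_zero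
    (eq_zero_of_reduction_eq_zero π hN he.idem (fun n _ => (he.central _).symm) h0)
  obtain ⟨c, hc⟩ := exists_reduction_eq_smul φ π hN hC (f := u.1) (fun n hn => by
    rw [hcomm, integralChar_eq_one (hlam n hn), Units.val_one, one_smul]) (he.val_mul u)
  have hc0 : c ≠ 0 := by
    rintro rfl
    rw [zero_smul] at hc
    refine hbar ?_
    have h1 : u.1 * v.1 = charIdempotent O Z φ := congrArg Subtype.val huv
    rw [← h1, map_mul, hc, zero_mul]
  have h1 := congrArg (reduction O π) (hcomm g)
  have h2 : single (π g) 1 * reduction O π (charIdempotent O Z φ) =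
      reduction O π (charIdempotent O Z φ) * single (π g) 1 := by
    rw [← map_one (IsLocalRing.residue O), ← reduction_single, ← map_mul, ← he.central, map_mul]
  rw [reduction_smul, map_mul, map_mul, hc, reduction_single, map_one, mul_smul_comm, h2,
    smul_mul_assoc, smul_smul, ← sub_eq_zero, ← sub_smul] at h1
  rcases smul_eq_zero.1 h1 with h3 | h3
  · refine hg (sub_eq_zero.1 ((mul_eq_zero.1 (?_ :
      (IsLocalRing.residue O (integralChar O lam g : O) - 1) * c = 0)).resolve_right hc0))
    rw [← neg_eq_zero, ← h3]
    ring
  · refine hbar ?_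
    have h4 := congrArg (· * single (π g)⁻¹ (1 : IsLocalRing.ResidueField O)) h3
    simpa [mul_assoc, MonoidAlgebra.single_mul_single, ← MonoidAlgebra.one_def] using h4

end Nontrivial

/-! ### Modules of the block algebra as representations of G -/

section BlockModules

variable {O : Type u} [CommRing O] [IsDomain O] [IsIntegrallyClosed O]
  {K : Type u} [Field K] [Algebra O K] [IsFractionRing O K]
  {G : Type} [Group G] [Finite G] {e : MonoidAlgebra O G} (he : IsBlockIdempotent e)
include he

/-- The representation of `G` over `K` on a module of the block algebra. -/
noncomputable def IsBlockIdempotent.moduleRep (K : Type u) [Field K] (V : Type u)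
    [AddCommGroup V] [Module he.Alg V] [Module K V]
    [SMulCommClass K he.Alg V] : Representation K G V where
  toFun g :=
    { toFun := fun v => he.of g • v
      map_add' := smul_add _
      map_smul' := fun c v => (smul_comm c _ v).symm }
  map_one' := by
    ext v
    change he.of 1 • v = v
    rw [map_one, one_smul]
  map_mul' g g' := by
    ext v
    change he.of (g * g') • v = he.of g • he.of g' • v
    rw [map_mul, mul_smul]

/-- Tensoring with a linear character fixes the irreducible characters in the block, if every
irreducible representation in the block has a nonzero operator that intertwines it with its tensor
product with the linear character. -/
theorem IsBlockIdempotent.fixesIrr_tensorBimod {lam : G →* Kˣ} (h : tensorChar O lam e = e)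
    (hsurj : Function.Surjective (he.tensorEnd lam h))
    (hT : ∀ (V : Type u) [AddCommGroup V] [Module O V] [Module he.Alg V] [Module K V]
      [IsScalarTower O he.Alg V] [IsScalarTower O K V] [SMulCommClass K he.Alg V],
      Nontrivial V →
      (∀ W : Submodule K V, (∀ g, ∀ w ∈ W, he.moduleRep K V g w ∈ W) → W = ⊥ ∨ W = ⊤) →
      ∃ T : V →ₗ[K] V, T ≠ 0 ∧
        ∀ g v, T (he.moduleRep K V g v) = (lam g : K) • he.moduleRep K V g (T v)) :
    (he.tensorBimod lam h).FixesIrr K := by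
  refine fixesIrr_twist K _ hsurj fun V _ _ _ _ _ _ _ hV => ?_
  obtain ⟨T, hT0, hTg⟩ := hT V hV.1 fun W hW => hV.2 W fun a w hw => by
    induction a using he.alg_induction with
    | hof g => exact hW g w hw
    | hadd x y hx hy => rw [add_smul]; exact W.add_mem hx hy
    | hsmul c x hx =>
      rw [smul_assoc, ← IsScalarTower.algebraMap_smul K c]
      exact W.smul_mem _ hx
  refine ⟨T, hT0, fun a v => ?_⟩
  induction a using he.alg_induction with
  | hof g =>
    rw [he.tensorEnd_of, smul_assoc, ← IsScalarTower.algebraMap_smul K (integralChar O lam g : O),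
      algebraMap_integralChar]
    exact hTg g v
  | hadd x y hx hy => rw [add_smul, map_add, hx, hy, map_add, add_smul]
  | hsmul c x hx =>
    rw [smul_assoc, ← IsScalarTower.algebraMap_smul K c, map_smul, hx, map_smul, smul_assoc,
      IsScalarTower.algebraMap_smul]

theorem IsBlockIdempotent.moduleRep_central (V : Type u) [AddCommGroup V] [Module O V]
    [Module he.Alg V] [Module K V] [IsScalarTower O he.Alg V] [IsScalarTower O K V]
    [SMulCommClass K he.Alg V] {z : G} {r : O} (hz : single z 1 * e = r • e) (v : V) :
    he.moduleRep K V z v = algebraMap O K r • v := by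
  have h1 : he.of z = r • 1 := Subtype.ext (by rw [he.of_val, hz]; rfl)
  change he.of z • v = _
  rw [h1, smul_assoc, one_smul, IsScalarTower.algebraMap_smul]

end BlockModules

/-! ### Simultaneous eigenvectors of a finite abelian group -/

section Characters

variable {D K V : Type*} [CommGroup D] [Finite D] [Field K] [CharZero K] [AddCommGroup V]
  [Module K V]

/-- A representation of a finite abelian group over a field with enough roots of unity has a
simultaneous eigenvector. -/
theorem exists_eigenvector [HasEnoughRootsOfUnity K (Monoid.exponent D)] [Nontrivial V]
    (τ : Representation K D V) :
    ∃ (ψ : D →* Kˣ) (v : V), v ≠ 0 ∧ ∀ d, τ d v = (ψ d : K) • v := by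
  classical
  have := Fintype.ofFinite D
  have : Finite (D →* Kˣ) := Finite.of_equiv D
    (CommGroup.monoidHom_mulEquiv_of_hasEnoughRootsOfUnity D K).some.symm.toEquiv
  have := Fintype.ofFinite (D →* Kˣ)
  obtain ⟨w, hw⟩ := exists_ne (0 : V)
  -- The component of w for ψ, up to the factor |D|. By orthogonality these components add up to a
  -- nonzero multiple of w, so one of them is nonzero; V need not be finite-dimensional.
  let ev : (D →* Kˣ) → V := fun ψ => ∑ d, ((ψ d)⁻¹ : Kˣ) • τ d w
  have hev : ∀ ψ d, τ d (ev ψ) = (ψ d : K) • ev ψ := fun ψ d => by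
    simp only [ev, map_sum, Finset.smul_sum]
    refine Fintype.sum_equiv (Equiv.mulLeft d) _ _ fun x => ?_
    simp only [Units.smul_def, map_smul, Equiv.coe_mulLeft, map_mul, Module.End.mul_apply,
      smul_smul, mul_inv, Units.val_mul, Units.mul_inv_cancel_left]
  by_contra! hcon
  have h0 : ∀ ψ, ev ψ = 0 := fun ψ => by
    by_contra hne
    obtain ⟨d, hd⟩ := hcon ψ (ev ψ) hne
    exact hd (hev ψ d)
  have hsum : ∑ ψ, ev ψ = (Fintype.card (D →* Kˣ) : K) • w := by
    simp only [ev]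
    rw [Finset.sum_comm, Finset.sum_eq_single 1]
    · simp [Nat.cast_smul_eq_nsmul]
    · intro d _ hd
      obtain ⟨χ, hχ⟩ := CommGroup.exists_apply_ne_one_of_hasEnoughRootsOfUnity D K hd
      simp only [Units.smul_def]
      rw [← Finset.sum_smul]
      have h1 : (((χ d)⁻¹ : Kˣ) : K) * ∑ ψ : D →* Kˣ, (((ψ d)⁻¹ : Kˣ) : K) =
          ∑ ψ : D →* Kˣ, (((ψ d)⁻¹ : Kˣ) : K) := by
        rw [Finset.mul_sum]
        refine Fintype.sum_equiv (Equiv.mulLeft χ) _ _ fun ψ => ?_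
        simp [mul_comm]
      have h2 : (((χ d)⁻¹ : Kˣ) : K) ≠ 1 := fun h => hχ (inv_eq_one.1 (Units.ext h))
      rw [(mul_left_eq_self₀.1 h1).resolve_left h2, zero_smul]
    · simp
  rw [Finset.sum_eq_zero fun ψ _ => h0 ψ] at hsum
  rcases smul_eq_zero.1 hsum.symm with h | h
  · exact Nat.cast_ne_zero.2 Fintype.card_ne_zero h
  · exact hw h

end Characters

open SemidirectProduct (inl inr rightHom)

/-! ### Calculations in E -/

section GroupE

variable {ℓ : ℕ} [NeZero ℓ]

theorem ofAdd_one_pow_val {m : ℕ} [NeZero m] (a : Multiplicative (ZMod m)) :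
    (Multiplicative.ofAdd (1 : ZMod m)) ^ a.toAdd.val = a := by
  rw [← ofAdd_nsmul, nsmul_one, ZMod.natCast_zmod_val, ofAdd_toAdd]

theorem elemz_pow (k : ℕ) :
    elemz ℓ ^ k = inl (Multiplicative.ofAdd (1 : ZMod ℓ) ^ k, 1) := by
  rw [elemz, ← map_pow, Prod.pow_mk, one_pow]

theorem elemg_pow (k : ℕ) :
    elemg ℓ ^ k = inl (1, Multiplicative.ofAdd (1 : ZMod (ℓ ^ 2)) ^ k) := by
  rw [elemg, ← map_pow, Prod.pow_mk, one_pow]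

theorem eq_pow_mul_pow_mul_pow (x : GroupE ℓ) : x = elemz ℓ ^ x.left.1.toAdd.val *
    elemg ℓ ^ x.left.2.toAdd.val * elemh ℓ ^ x.right.toAdd.val := by
  rw [elemz_pow, elemg_pow, elemh, ← map_pow (inr : _ →* GroupE ℓ), ofAdd_one_pow_val,
    ofAdd_one_pow_val, ofAdd_one_pow_val, ← map_mul, Prod.mk_mul_mk, mul_one, one_mul]
  exact (SemidirectProduct.inl_left_mul_inr_right x).symm

theorem elemz_pow_self : elemz ℓ ^ ℓ = 1 := by
  rw [elemz_pow, ← ofAdd_nsmul, nsmul_one, ZMod.natCast_self, ofAdd_zero]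
  exact map_one _

theorem GroupE_ext {x y : GroupE ℓ} (h1 : x.left.1.toAdd = y.left.1.toAdd)
    (h2 : x.left.2 = y.left.2) (h3 : x.right = y.right) : x = y :=
  SemidirectProduct.ext (Prod.ext (Multiplicative.toAdd.injective h1) h2) h3

theorem elemz_mul_comm (x : GroupE ℓ) : elemz ℓ * x = x * elemz ℓ := by
  refine GroupE_ext ?_ ?_ ?_
  · change (1 : ZMod ℓ) + (x.left.1.toAdd + 0 * reduceHom ℓ x.left.2.toAdd) =
      x.left.1.toAdd + (1 + x.right.toAdd * reduceHom ℓ 0)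
    rw [map_zero, zero_mul, mul_zero, add_zero, add_zero, add_comm]
  · exact mul_comm (1 : Multiplicative (ZMod (ℓ ^ 2))) x.left.2
  · exact mul_comm (1 : Multiplicative (ZMod ℓ)) x.right

theorem elemh_mul_elemg : elemh ℓ * elemg ℓ = elemg ℓ * elemz ℓ * elemh ℓ := by
  refine GroupE_ext ?_ ?_ ?_
  · change (0 : ZMod ℓ) + (0 + 1 * reduceHom ℓ 1) = 0 + (1 + 0 * reduceHom ℓ 0) +
      (0 + (0 + 0) * reduceHom ℓ 0)
    simp
  · change (1 : Multiplicative (ZMod (ℓ ^ 2))) * Multiplicative.ofAdd 1 =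
      Multiplicative.ofAdd 1 * 1 * 1
    simp
  · change (Multiplicative.ofAdd 1 : Multiplicative (ZMod ℓ)) * 1 = 1 * 1 * Multiplicative.ofAdd 1
    simp

/-- Needed for k = ℓ, where the power of z disappears and h commutes with g^ℓ. -/
theorem elemh_mul_elemg_pow (k : ℕ) :
    elemh ℓ * elemg ℓ ^ k = elemg ℓ ^ k * elemz ℓ ^ k * elemh ℓ := by
  induction k with
  | zero => simp
  | succ k ih =>
    have h1 : elemz ℓ ^ k * elemg ℓ = elemg ℓ * elemz ℓ ^ k :=
      (show Commute (elemz ℓ) (elemg ℓ) from elemz_mul_comm _).pow_left k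
    calc elemh ℓ * elemg ℓ ^ (k + 1) = elemh ℓ * elemg ℓ ^ k * elemg ℓ := by
          rw [pow_succ (elemg ℓ), mul_assoc]
      _ = elemg ℓ ^ k * elemz ℓ ^ k * (elemh ℓ * elemg ℓ) := by rw [ih, mul_assoc]
      _ = elemg ℓ ^ k * (elemz ℓ ^ k * elemg ℓ) * (elemz ℓ * elemh ℓ) := by
          rw [elemh_mul_elemg]; simp only [mul_assoc]
      _ = elemg ℓ ^ (k + 1) * elemz ℓ ^ (k + 1) * elemh ℓ := by
          rw [h1, pow_succ (elemg ℓ), pow_succ (elemz ℓ)]; simp only [mul_assoc]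

variable {U : Type*} [CommGroup U] {x y : U} (hx : x ^ ℓ ^ 2 = 1) (hy : y ^ ℓ = 1)

theorem homE_apply (s : GroupE ℓ) :
    homE ℓ x y hx hy s = x ^ s.left.2.toAdd.val * y ^ s.right.toAdd.val := rfl

variable {F : Type*} [Field F] {ω : Fˣ} (hω : IsPrimitiveRoot ω (ℓ ^ 2))

/-- The elements of `E` that act trivially on both factors of `D` are the powers of `z`. -/
theorem mem_zpowers_elemz (h2 : ((ω ^ ℓ)⁻¹) ^ ℓ = 1) {s : GroupE ℓ}
    (hs1 : homE ℓ ω 1 hω.pow_eq_one (one_pow ℓ) s = 1)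
    (hs2 : homE ℓ ω (ω ^ ℓ)⁻¹ hω.pow_eq_one h2 s = 1) : s ∈ Subgroup.zpowers (elemz ℓ) := by
  -- With exponents b of g and c of h, the first character gives ω^b = 1 with b < ℓ², so b = 0. The
  -- second becomes ω^(-ℓc) = 1, so ℓ divides c < ℓ, and c = 0.
  rw [homE_apply, one_pow, mul_one, hω.pow_eq_one_iff_dvd] at hs1
  have h0 : s.left.2.toAdd.val = 0 := Nat.eq_zero_of_dvd_of_lt hs1 (ZMod.val_lt _)
  rw [homE_apply, h0, pow_zero, one_mul, inv_pow, inv_eq_one, ← pow_mul,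
    hω.pow_eq_one_iff_dvd] at hs2
  have h0' : s.right.toAdd.val = 0 := Nat.eq_zero_of_dvd_of_lt
    (Nat.dvd_of_mul_dvd_mul_left (NeZero.pos ℓ) (sq ℓ ▸ hs2)) (ZMod.val_lt _)
  rw [eq_pow_mul_pow_mul_pow s, h0, h0', pow_zero, pow_zero, mul_one, mul_one]
  exact Subgroup.npow_mem_zpowers _ _

theorem card_GroupE : Nat.card (GroupE ℓ) = ℓ ^ 4 := by
  rw [SemidirectProduct.card, Nat.card_prod]
  simp only [Nat.card_eq_fintype_card, Fintype.card_multiplicative, ZMod.card]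
  ring

end GroupE

/-! ### Centralizer of D and commutators in G -/

section GroupG

variable {ℓ : ℕ} [NeZero ℓ] {p : ℕ} [Fact p.Prime] {ω : (FieldF ℓ p)ˣ}
  {hω : IsPrimitiveRoot ω (ℓ ^ 2)}

variable (hω) in
/-- The character by which `E` acts on `D₁`. -/
noncomputable def charOne : GroupE ℓ →* (FieldF ℓ p)ˣ := homE ℓ ω 1 hω.pow_eq_one (one_pow ℓ)

variable (hω) in
/-- The character by which `E` acts on `D₂`. -/
noncomputable def charTwo : GroupE ℓ →* (FieldF ℓ p)ˣ :=
  homE ℓ ω (ω ^ ℓ)⁻¹ hω.pow_eq_one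
    (by rw [inv_pow, ← pow_mul, ← sq, hω.pow_eq_one, inv_one])

theorem actionE_apply (s : GroupE ℓ) (a b : FieldF ℓ p) :
    actionE ℓ ω hω s (Multiplicative.ofAdd a, Multiplicative.ofAdd b) =
      (Multiplicative.ofAdd ((charOne hω s : FieldF ℓ p) * a),
        Multiplicative.ofAdd ((charTwo hω s : FieldF ℓ p) * b)) := rfl

theorem mem_zpowers_elemz_of_char {s : GroupE ℓ} (h1 : charOne hω s = 1) (h2 : charTwo hω s = 1) :
    s ∈ Subgroup.zpowers (elemz ℓ) := mem_zpowers_elemz hω _ h1 h2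

theorem subD_eq_ker : subD ℓ ω hω = (rightHom : GroupG ℓ ω hω →* GroupE ℓ).ker :=
  SemidirectProduct.range_inl_eq_ker_rightHom

theorem pow_char_GroupD (d : GroupD ℓ p) : d ^ p = 1 := by
  refine Prod.ext (Multiplicative.toAdd.injective ?_) (Multiplicative.toAdd.injective ?_) <;>
  · simp [CharP.cast_eq_zero]

theorem isPGroup_ker : IsPGroup p (rightHom : GroupG ℓ ω hω →* GroupE ℓ).ker := by
  rintro ⟨x, hx⟩
  rw [← subD_eq_ker] at hx
  obtain ⟨d, rfl⟩ := hx
  refine ⟨1, Subtype.ext ?_⟩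
  change inl d ^ p ^ 1 = 1
  rw [pow_one, ← map_pow, pow_char_GroupD, map_one]

theorem map_subZ : (subZ ℓ ω hω).map rightHom = Subgroup.zpowers (elemz ℓ) := by
  rw [subZ, MonoidHom.map_zpowers, SemidirectProduct.rightHom_inr]

theorem actionE_elemz : actionE ℓ ω hω (elemz ℓ) = 1 := by
  have h1 : charOne hω (elemz ℓ) = 1 := by
    rw [charOne, homE_apply]; simp [elemz]
  have h2 : charTwo hω (elemz ℓ) = 1 := by
    rw [charTwo, homE_apply]; simp [elemz]
  refine MulEquiv.ext fun d => ?_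
  obtain ⟨a, b⟩ := d
  refine (actionE_apply (elemz ℓ) a.toAdd b.toAdd).trans ?_
  rw [h1, h2, Units.val_one, one_mul, one_mul]
  rfl

theorem subZ_le_center : subZ ℓ ω hω ≤ Subgroup.center (GroupG ℓ ω hω) := by
  rw [subZ, Subgroup.zpowers_le, Subgroup.mem_center_iff]
  intro x
  rw [← SemidirectProduct.inl_left_mul_inr_right x, mul_assoc, ← map_mul, ← elemz_mul_comm,
    map_mul, ← mul_assoc, ← mul_assoc]
  congr 1
  have h := SemidirectProduct.inl_aut (φ := actionE ℓ ω hω) (elemz ℓ) x.left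
  rw [actionE_elemz, MulAut.one_apply] at h
  conv_lhs => rw [h]
  rw [map_inv, inv_mul_cancel_right]

theorem isUnit_card_subZ {O : Type*} [CommRing O] (hℓ : IsUnit (ℓ : O)) :
    IsUnit (Nat.card (subZ ℓ ω hω) : O) := by
  have h : Nat.card (subZ ℓ ω hω) ∣ ℓ := by
    rw [subZ, Nat.card_zpowers]
    refine orderOf_dvd_of_pow_eq_one ?_
    rw [← map_pow, elemz_pow_self, map_one]
  exact isUnit_of_dvd_unit (Nat.cast_dvd_cast h) hℓ

theorem isUnit_index_ker {O : Type*} [CommRing O] (hℓ : IsUnit (ℓ : O)) :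
    IsUnit ((rightHom : GroupG ℓ ω hω →* GroupE ℓ).ker.index : O) := by
  have h : (rightHom : GroupG ℓ ω hω →* GroupE ℓ).ker.index = ℓ ^ 4 := by
    rw [Subgroup.index_ker, MonoidHom.range_eq_top.2 SemidirectProduct.rightHom_surjective,
      Subgroup.card_top, card_GroupE]
  rw [h, Nat.cast_pow]
  exact hℓ.pow 4

theorem conj_inl (x : GroupG ℓ ω hω) (d : GroupD ℓ p) :
    x * inl d * x⁻¹ = inl (actionE ℓ ω hω x.right d) := by
  have h : inr x.right * inl d * inr x.right⁻¹ = inl (actionE ℓ ω hω x.right d) :=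
    (SemidirectProduct.inl_aut _ _).symm
  have h2 : x = inl x.left * inr x.right := (SemidirectProduct.inl_left_mul_inr_right x).symm
  conv_lhs => rw [h2]
  rw [mul_inv_rev, ← map_inv inr]
  calc _ = inl x.left * (inr x.right * inl d * inr x.right⁻¹) * (inl x.left)⁻¹ := by group
    _ = _ := by rw [h, ← map_inv, ← map_mul, ← map_mul, mul_comm x.left, mul_inv_cancel_right]

/-- Both factors of E's action are multiplications by field elements, so it suffices to test the
vector whose two coordinates are the field element 1. -/
theorem rightHom_mem_of_mem_centralizer {x : GroupG ℓ ω hω}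
    (hx : x ∈ Subgroup.centralizer ((rightHom : GroupG ℓ ω hω →* GroupE ℓ).ker : Set _)) :
    rightHom x ∈ (subZ ℓ ω hω).map rightHom := by
  rw [map_subZ]
  have h1 : inl (actionE ℓ ω hω x.right (Multiplicative.ofAdd 1, Multiplicative.ofAdd 1)) =
      (inl (Multiplicative.ofAdd 1, Multiplicative.ofAdd 1) : GroupG ℓ ω hω) := by
    rw [← conj_inl, ← Subgroup.mem_centralizer_iff.1 hx _ (by
      rw [← subD_eq_ker]; exact ⟨_, rfl⟩), mul_inv_cancel_right]
  have h2 := SemidirectProduct.inl_injective h1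
  rw [actionE_apply, Prod.mk.injEq, mul_one, mul_one] at h2
  exact mem_zpowers_elemz_of_char (hω := hω) (Units.ext h2.1) (Units.ext h2.2)

/-- The two characters of E take values in an abelian group and have common kernel ⟨z⟩, so E/⟨z⟩ is
abelian. -/
theorem rightHom_commutator_mem (x y : GroupG ℓ ω hω) :
    rightHom (x * y * x⁻¹ * y⁻¹) ∈ (subZ ℓ ω hω).map rightHom := by
  rw [map_subZ]
  refine mem_zpowers_elemz_of_char (hω := hω) ?_ ?_ <;>
  · simp only [map_mul, map_inv]
    rw [mul_inv_eq_one, mul_inv_eq_iff_eq_mul, mul_comm]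

theorem mem_of_generators {S : Subgroup (GroupG ℓ ω hω)} (hD : ∀ d, inl d ∈ S)
    (hz : inr (elemz ℓ) ∈ S) (hg : inr (elemg ℓ) ∈ S) (hh : inr (elemh ℓ) ∈ S)
    (x : GroupG ℓ ω hω) : x ∈ S := by
  rw [← SemidirectProduct.inl_left_mul_inr_right x]
  refine S.mul_mem (hD _) ?_
  rw [eq_pow_mul_pow_mul_pow x.right, map_mul, map_mul, map_pow, map_pow, map_pow]
  exact S.mul_mem (S.mul_mem (S.pow_mem hz _) (S.pow_mem hg _)) (S.pow_mem hh _)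

end GroupG

/-- The elements on which `T` intertwines a representation with its tensor product with a linear
character. -/
def intertwinedSubgroup {G K V : Type*} [Group G] [Field K] [AddCommGroup V] [Module K V]
    (σ : Representation K G V) (lam : G →* Kˣ) (T : Module.End K V) : Subgroup G where
  carrier := {x | T * σ x = (lam x : K) • (σ x * T)}
  one_mem' := by simp
  mul_mem' {x y} hx hy := by
    change T * σ (x * y) = (lam (x * y) : K) • (σ (x * y) * T)
    rw [map_mul, ← mul_assoc, show T * σ x = _ from hx, smul_mul_assoc, mul_assoc,
      show T * σ y = _ from hy, mul_smul_comm, smul_smul, map_mul, Units.val_mul, mul_assoc]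
  inv_mem' {x} hx := by
    change T * σ x⁻¹ = (lam x⁻¹ : K) • (σ x⁻¹ * T)
    have h1 : σ x⁻¹ * T = (lam x : K) • (T * σ x⁻¹) := by
      calc σ x⁻¹ * T = σ x⁻¹ * (T * σ x) * σ x⁻¹ := by
            rw [mul_assoc, mul_assoc, ← map_mul, mul_inv_cancel, map_one, mul_one]
        _ = _ := by
            rw [show T * σ x = _ from hx, mul_smul_comm, smul_mul_assoc, ← mul_assoc, ← map_mul,
              inv_mul_cancel, map_one, one_mul]
    rw [h1, smul_smul, map_inv lam, Units.inv_mul, one_smul]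

/-! ### Intertwining an irreducible representation with its tensor product with λ -/

section Intertwiner

variable {ℓ : ℕ} [NeZero ℓ] {p : ℕ} [Fact p.Prime] {ω : (FieldF ℓ p)ˣ}
  {hω : IsPrimitiveRoot ω (ℓ ^ 2)} {K V : Type*} [Field K] [AddCommGroup V] [Module K V]
  {σ : Representation K (GroupG ℓ ω hω) V} {lam : GroupG ℓ ω hω →* Kˣ}

theorem rep_inr_mul_inl (s : GroupE ℓ) (d : GroupD ℓ p) :
    σ (inr s) * σ (inl d) = σ (inl (actionE ℓ ω hω s d)) * σ (inr s) := by
  have h := conj_inl (inr s : GroupG ℓ ω hω) d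
  rw [SemidirectProduct.right_inr, mul_inv_eq_iff_eq_mul] at h
  rw [← map_mul, h, map_mul]

/-- An element of `E` that commutes with `g` up to `z` and centralizes the image of `D` gives an
intertwiner. -/
theorem exists_intertwiner_of_element [Nontrivial V] {ζ : K}
    (hz : σ (inr (elemz ℓ)) = ζ • 1) (hlD : ∀ d, lam (inl d) = 1)
    (hlz : lam (inr (elemz ℓ)) = 1) (hlh : lam (inr (elemh ℓ)) = 1)
    {j : ℕ} (hlg : ζ ^ j = lam (inr (elemg ℓ))) {t : GroupE ℓ}
    (htg : t * elemg ℓ = elemg ℓ * elemz ℓ * t) (hth : t * elemh ℓ = elemh ℓ * t)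
    (htD : ∀ d, σ (inl (actionE ℓ ω hω t d)) = σ (inl d)) :
    ∃ T : V →ₗ[K] V, T ≠ 0 ∧ ∀ x v, T (σ x v) = (lam x : K) • σ x (T v) := by
  let T : Module.End K V := σ (inr t) ^ j
  have hTne : T ≠ 0 := fun h0 => by
    have h1 : T * σ (inr t ^ j)⁻¹ = 1 := by
      rw [show T = σ (inr t ^ j) from (map_pow σ _ _).symm, ← map_mul, mul_inv_cancel, map_one]
    rw [h0, zero_mul] at h1
    exact zero_ne_one h1
  have hcomm : ∀ x : GroupG ℓ ω hω, Commute (σ (inr t)) (σ x) → T * σ x = σ x * T :=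
    fun x hx => hx.pow_left j
  -- The condition on x defines a subgroup, so only D and the generators z, g, h have to be checked;
  -- each exchange of t with g contributes one factor ζ.
  suffices h : ∀ x, x ∈ intertwinedSubgroup σ lam T from
    ⟨T, hTne, fun x v => LinearMap.congr_fun (h x) v⟩
  refine mem_of_generators (fun d => ?_) ?_ ?_ ?_
  · change T * _ = _ • (_ * T)
    rw [hlD, Units.val_one, one_smul]
    refine hcomm _ ?_
    change _ * _ = _ * _
    rw [rep_inr_mul_inl, htD]
  · change T * _ = _ • (_ * T)
    rw [hlz, Units.val_one, one_smul, hz, mul_smul_comm, smul_mul_assoc, one_mul, mul_one]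
  · change T * _ = _ • (_ * T)
    rw [← hlg]
    have h1 : σ (inr t) * σ (inr (elemg ℓ)) = ζ • (σ (inr (elemg ℓ)) * σ (inr t)) := by
      rw [← map_mul, ← map_mul, htg, map_mul, map_mul, map_mul, map_mul, hz, mul_smul_comm,
        mul_one, smul_mul_assoc]
    change σ (inr t) ^ j * _ = ζ ^ j • (_ * σ (inr t) ^ j)
    clear hlg hTne hcomm
    induction j with
    | zero => simp
    | succ j ih =>
      rw [pow_succ, mul_assoc, h1, mul_smul_comm, ← mul_assoc, ih, smul_mul_assoc, smul_smul,
        pow_succ' ζ, mul_assoc]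
  · change T * _ = _ • (_ * T)
    rw [hlh, Units.val_one, one_smul]
    refine hcomm _ ?_
    change _ * _ = _ * _
    rw [← map_mul, ← map_mul, hth, map_mul, map_mul]

/-- A subset of `D` that is stable under `E` and fixes a nonzero vector of an irreducible
representation acts trivially. -/
theorem rep_eq_one_of_fixed
    (hirr : ∀ W : Submodule K V, (∀ x, ∀ w ∈ W, σ x w ∈ W) → W = ⊥ ∨ W = ⊤)
    {D' : Set (GroupD ℓ p)} (hD' : ∀ s, ∀ d ∈ D', actionE ℓ ω hω s d ∈ D') {v : V} (hv : v ≠ 0)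
    (hfix : ∀ d ∈ D', σ (inl d) v = v) {d : GroupD ℓ p} (hd : d ∈ D') : σ (inl d) = 1 := by
  let W : Submodule K V :=
    { carrier := {w | ∀ d ∈ D', σ (inl d) w = w}
      zero_mem' := fun d _ => map_zero _
      add_mem' := fun ha hb d hd => by rw [map_add, ha d hd, hb d hd]
      smul_mem' := fun c w hw d hd => by rw [map_smul, hw d hd] }
  -- The vectors fixed by `D'` form a G-stable subspace, because conjugation by G acts on D through
  -- E and preserves `D'`; it contains v.
  have hW : W = ⊤ := by
    refine (hirr W fun x w hw d hd => ?_).resolve_left fun h => hv ?_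
    · have h1 := conj_inl x⁻¹ d
      rw [inv_inv] at h1
      have h2 : inl d * x = x * inl (actionE ℓ ω hω (x⁻¹).right d) := by
        rw [← h1]; group
      rw [← Module.End.mul_apply, ← map_mul, h2, map_mul, Module.End.mul_apply,
        hw _ (hD' _ d hd)]
    · exact (Submodule.mem_bot K).1 (h ▸ (show v ∈ W from hfix))
  refine LinearMap.ext fun w => ?_
  exact (show w ∈ W from hW ▸ Submodule.mem_top) d hd

theorem lam_eq_one (hlD : ∀ d, lam (inl d) = 1)
    (hlz : lam (inr (elemz ℓ)) = 1) {x : GroupG ℓ ω hω}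
    (h1 : charOne hω x.right = 1) (h2 : charTwo hω x.right = 1) : lam x = 1 := by
  obtain ⟨k, hk⟩ := mem_zpowers_elemz_of_char h1 h2
  rw [← SemidirectProduct.inl_left_mul_inr_right x, ← hk, map_mul, hlD, one_mul]
  change lam (inr (elemz ℓ ^ k)) = 1
  rw [map_zpow, map_zpow, hlz, one_zpow]

/-- If u ≠ 1, every b has the form u c - c with c = b / (u - 1), so ψ(b) = 1. Hence a field element
other than 1 stabilizes no nontrivial character. -/
theorem eq_one_of_forall_mul {F M : Type*} [Field F] [CommGroup M]
    (ψ : Multiplicative F →* M) {u : F} (hu : ∀ a, ψ (Multiplicative.ofAdd (u * a)) =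
      ψ (Multiplicative.ofAdd a)) {b : Multiplicative F} (hb : ψ b ≠ 1) : u = 1 := by
  by_contra hne
  refine hb ?_
  have h1 : b.toAdd = u * ((u - 1)⁻¹ * b.toAdd) - (u - 1)⁻¹ * b.toAdd := by
    field_simp [sub_ne_zero.2 hne]
  rw [← ofAdd_toAdd b, h1, ofAdd_sub, map_div, hu, div_self']

/-- If a character of `D` that is nontrivial on both factors occurs in a representation, then the
representation is isomorphic to its tensor products with the linear characters of `G / DZ`. -/
theorem exists_intertwiner_of_character [CharZero K] (hlD : ∀ d, lam (inl d) = 1)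
    (hlz : lam (inr (elemz ℓ)) = 1) {ψ : GroupD ℓ p →* Kˣ} {v : V} (hv0 : v ≠ 0)
    (hv : ∀ d, σ (inl d) v = (ψ d : K) • v)
    (h1 : ∃ d : GroupD ℓ p, d.2 = 1 ∧ ψ d ≠ 1) (h2 : ∃ d : GroupD ℓ p, d.1 = 1 ∧ ψ d ≠ 1) :
    ∃ T : V →ₗ[K] V, T ≠ 0 ∧ ∀ x v, T (σ x v) = (lam x : K) • σ x (T v) := by
  classical
  have := Fintype.ofFinite (GroupG ℓ ω hω)
  have := Fintype.ofFinite (GroupD ℓ p)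
  -- Up to the factor |D|, `e` is the projection to the ψ-eigenspace. The weights λ(x) make the sum
  -- `T` of its conjugates an intertwiner, by the substitution x ↦ y x.
  let e : Module.End K V := ∑ d : GroupD ℓ p, (((ψ d)⁻¹ : Kˣ) : K) • σ (inl d)
  let T : Module.End K V := ∑ x, (lam x : K) • (σ x * e * σ x⁻¹)
  have hT : ∀ y, T * σ y = (lam y : K) • (σ y * T) := fun y => by
    simp only [T]
    rw [Finset.sum_mul, Finset.mul_sum, Finset.smul_sum]
    symm
    refine Fintype.sum_equiv (Equiv.mulLeft y) _ _ fun x => ?_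
    rw [Equiv.coe_mulLeft, smul_mul_assoc, mul_smul_comm, smul_smul, map_mul lam, Units.val_mul,
      mul_inv_rev, mul_assoc _ (σ (x⁻¹ * y⁻¹)), ← map_mul σ (x⁻¹ * y⁻¹), inv_mul_cancel_right,
      map_mul σ y x]
    simp only [mul_assoc]
  refine ⟨T, fun hT0 => ?_, fun x v => LinearMap.congr_fun (hT x) v⟩
  -- The quotient of the conjugate of ψ under x by ψ. By orthogonality the conjugate of `e` by x
  -- kills v unless this quotient is trivial, that is, unless x stabilizes ψ.
  let χ : GroupG ℓ ω hω → GroupD ℓ p →* K := fun x =>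
    (Units.coeHom K).comp (ψ⁻¹ * ψ.comp (actionE ℓ ω hω x.right).toMonoidHom)
  have hconj : ∀ x, (σ x * e * σ x⁻¹) v = (∑ d, χ x d) • v := fun x => by
    simp only [e]
    rw [Finset.mul_sum, Finset.sum_mul, LinearMap.sum_apply, Finset.sum_smul]
    refine Finset.sum_congr rfl fun d _ => ?_
    rw [mul_smul_comm, smul_mul_assoc, ← map_mul, ← map_mul, conj_inl, LinearMap.smul_apply, hv,
      smul_smul]
    rfl
  have hχ : ∀ x, χ x = 1 → lam x = 1 := fun x hx => by
    have hψ : ∀ d, ψ (actionE ℓ ω hω x.right d) = ψ d := fun d => by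
      have h3 : ((ψ d)⁻¹ * ψ (actionE ℓ ω hω x.right d) : Kˣ) = 1 :=
        Units.ext (DFunLike.congr_fun hx d)
      rwa [inv_mul_eq_one, eq_comm] at h3
    refine lam_eq_one hlD hlz ?_ ?_
    · obtain ⟨⟨a, b⟩, hb, hne⟩ := h1
      obtain rfl : b = 1 := hb
      refine Units.ext (eq_one_of_forall_mul (ψ.comp (MonoidHom.inl _ _)) (fun c => ?_)
        (b := a) hne)
      have h4 := hψ (Multiplicative.ofAdd c, Multiplicative.ofAdd 0)
      rw [actionE_apply, mul_zero] at h4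
      exact h4
    · obtain ⟨⟨a, b⟩, ha, hne⟩ := h2
      obtain rfl : a = 1 := ha
      refine Units.ext (eq_one_of_forall_mul (ψ.comp (MonoidHom.inr _ _)) (fun c => ?_)
        (b := b) hne)
      have h4 := hψ (Multiplicative.ofAdd 0, Multiplicative.ofAdd c)
      rw [actionE_apply, mul_zero] at h4
      exact h4
  have hterm : ∀ x, (lam x : K) * ∑ d, χ x d =
      ((if χ x = 1 then Fintype.card (GroupD ℓ p) else 0 : ℕ) : K) := fun x => by
    rw [sum_hom_units]
    split_ifs with h
    · rw [hχ x h, Units.val_one, one_mul]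
    · rw [Nat.cast_zero, mul_zero]
  -- On the stabilizer of ψ the weight λ is 1, so no cancellation occurs: v is multiplied by a
  -- natural number, positive because x = 1 contributes.
  have hTv : T v =
      ((∑ x, if χ x = 1 then Fintype.card (GroupD ℓ p) else 0 : ℕ) : K) • v := by
    simp only [T]
    rw [LinearMap.sum_apply, Nat.cast_sum, Finset.sum_smul]
    refine Finset.sum_congr rfl fun x _ => ?_
    rw [LinearMap.smul_apply, hconj, smul_smul, hterm]
  rw [hT0, LinearMap.zero_apply] at hTv
  refine (smul_ne_zero (Nat.cast_ne_zero.2 ?_) hv0) hTv.symm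
  have hone : χ 1 = 1 := by
    ext d
    simp [χ]
  refine (Finset.sum_pos' (fun _ _ => Nat.zero_le _) ⟨1, Finset.mem_univ _, ?_⟩).ne'
  rw [if_pos hone]
  exact Fintype.card_pos

theorem charOne_elemh : charOne hω (elemh ℓ) = 1 := by
  rw [charOne, homE_apply]; simp [elemh]

theorem charTwo_elemg_pow_mul_elemh (hℓ : 1 < ℓ) :
    charTwo hω (elemg ℓ ^ ℓ * elemh ℓ) = 1 := by
  have : Fact (1 < ℓ) := ⟨hℓ⟩
  have : Fact (1 < ℓ ^ 2) := ⟨one_lt_pow₀ hℓ two_ne_zero⟩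
  have h1 : charTwo hω (elemg ℓ) = ω := by
    rw [charTwo, homE_apply]; simp [elemg, ZMod.val_one]
  have h2 : charTwo hω (elemh ℓ) = (ω ^ ℓ)⁻¹ := by
    rw [charTwo, homE_apply]; simp [elemh, ZMod.val_one]
  rw [map_mul, map_pow, h1, h2, mul_inv_cancel]

/-- The irreducible representations of `G` on which `z` acts by a nontrivial scalar are isomorphic
to their tensor products with the linear characters of `G / (D ⋊ F)`. -/
theorem exists_intertwiner [CharZero K] [Nontrivial V] (hℓ : ℓ.Prime)
    [HasEnoughRootsOfUnity K (Monoid.exponent (GroupD ℓ p))] {ζ : K} (hζ : ζ ^ ℓ = 1)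
    (hζ1 : ζ ≠ 1)
    (hirr : ∀ W : Submodule K V, (∀ x, ∀ w ∈ W, σ x w ∈ W) → W = ⊥ ∨ W = ⊤)
    (hz : ∀ v, σ (inr (elemz ℓ)) v = ζ • v) (hlD : ∀ d, lam (inl d) = 1)
    (hlz : lam (inr (elemz ℓ)) = 1) (hlh : lam (inr (elemh ℓ)) = 1)
    (hlg : lam (inr (elemg ℓ)) ^ ℓ = 1) :
    ∃ T : V →ₗ[K] V, T ≠ 0 ∧ ∀ x v, T (σ x v) = (lam x : K) • σ x (T v) := by
  have hz' : σ (inr (elemz ℓ)) = ζ • 1 := LinearMap.ext hz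
  have hprim : IsPrimitiveRoot ζ ℓ := by
    have := Fact.mk hℓ
    exact orderOf_eq_prime hζ hζ1 ▸ IsPrimitiveRoot.orderOf ζ
  -- Both ζ and λ(g) are ℓ-th roots of unity and ζ is primitive, so λ(g) = ζ^j.
  obtain ⟨j, -, hj⟩ := hprim.eq_pow_of_pow_eq_one (ξ := (lam (inr (elemg ℓ)) : K))
    (by rw [← Units.val_pow_eq_pow_val, hlg, Units.val_one])
  obtain ⟨ψ, v, hv0, hv⟩ := exists_eigenvector (σ.comp (inl : GroupD ℓ p →* GroupG ℓ ω hω))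
  replace hv : ∀ d, σ (inl d) v = (ψ d : K) • v := hv
  -- If ψ is trivial on an E-stable `D'`, then `D'` acts trivially on V; an element t that moves
  -- each d only by a factor in `D'` then commutes with the image of D.
  have key : ∀ (t : GroupE ℓ) (D' : Set (GroupD ℓ p)),
      (∀ s, ∀ d ∈ D', actionE ℓ ω hω s d ∈ D') → (∀ d ∈ D', ψ d = 1) →
      (∀ d, d⁻¹ * actionE ℓ ω hω t d ∈ D') →
      ∀ d, σ (inl (actionE ℓ ω hω t d)) = σ (inl d) := fun t D' hD' hψ ht d => by
    have h1 := rep_eq_one_of_fixed hirr hD' hv0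
      (fun d hd => by rw [hv, hψ d hd, Units.val_one, one_smul]) (ht d)
    rw [← mul_one (σ (inl d)), ← h1, ← map_mul, ← map_mul, mul_inv_cancel_left]
  by_cases h2 : ∃ d : GroupD ℓ p, d.1 = 1 ∧ ψ d ≠ 1
  · by_cases h1 : ∃ d : GroupD ℓ p, d.2 = 1 ∧ ψ d ≠ 1
    · exact exists_intertwiner_of_character hlD hlz hv0 hv h1 h2
    · push Not at h1
      -- Here ψ is trivial on D₁ = {d | d.2 = 1}, and g^ℓ h acts trivially on D₂.
      refine exists_intertwiner_of_element hz' hlD hlz hlh hj (t := elemg ℓ ^ ℓ * elemh ℓ) ?_ ?_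
        (key _ {d | d.2 = 1} ?_ h1 ?_)
      · have h3 : Commute (elemg ℓ ^ ℓ) (elemg ℓ * elemz ℓ) :=
          (Commute.pow_self _ _).mul_right (elemz_mul_comm _).symm
        rw [mul_assoc, elemh_mul_elemg, ← mul_assoc, h3.eq, mul_assoc]
      · rw [← mul_assoc, elemh_mul_elemg_pow, elemz_pow_self, mul_one]
      · rintro s ⟨a, b⟩ hb
        obtain rfl : b = 1 := hb
        exact map_one (unitAction (FieldF ℓ p) (charTwo hω s))
      · rintro ⟨a, b⟩
        change b⁻¹ * Multiplicative.ofAdd ((charTwo hω _ : FieldF ℓ p) * b.toAdd) = 1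
        rw [charTwo_elemg_pow_mul_elemh hℓ.one_lt, Units.val_one, one_mul, ofAdd_toAdd,
          inv_mul_cancel]
  · push Not at h2
    -- Here ψ is trivial on D₂ = {d | d.1 = 1}, and h acts trivially on D₁. This includes the case
    -- of trivial ψ.
    refine exists_intertwiner_of_element hz' hlD hlz hlh hj elemh_mul_elemg rfl
      (key _ {d | d.1 = 1} ?_ h2 ?_)
    · rintro s ⟨a, b⟩ ha
      obtain rfl : a = 1 := ha
      exact map_one (unitAction (FieldF ℓ p) (charOne hω s))
    · rintro ⟨a, b⟩
      change a⁻¹ * Multiplicative.ofAdd ((charOne hω _ : FieldF ℓ p) * a.toAdd) = 1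
      rw [charOne_elemh, Units.val_one, one_mul, ofAdd_toAdd, inv_mul_cancel]

end Intertwiner

/-! ### Roots of unity and the characters φ and λ -/

section Parameters

variable {ℓ : ℕ} [NeZero ℓ] {p : ℕ} [Fact p.Prime] {ω : (FieldF ℓ p)ˣ}
  {hω : IsPrimitiveRoot ω (ℓ ^ 2)} {K : Type*} [Field K]

theorem hasEnoughRootsOfUnity_exponent
    (hK : ∃ ζ : K, IsPrimitiveRoot ζ (Nat.card (GroupG ℓ ω hω))) :
    HasEnoughRootsOfUnity K (Monoid.exponent (GroupD ℓ p)) := by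
  have : NeZero (Nat.card (GroupG ℓ ω hω)) := ⟨Nat.card_pos.ne'⟩
  have : HasEnoughRootsOfUnity K (Nat.card (GroupG ℓ ω hω)) := ⟨hK, inferInstance⟩
  refine HasEnoughRootsOfUnity.of_dvd K (n := Nat.card (GroupG ℓ ω hω))
    (Group.exponent_dvd_nat_card.trans ?_)
  rw [SemidirectProduct.card]
  exact dvd_mul_right _ _

theorem mem_subZ_elemz : (inr (elemz ℓ) : GroupG ℓ ω hω) ∈ subZ ℓ ω hω :=
  Subgroup.mem_zpowers _

theorem inl_mem_subDF (d : GroupD ℓ p) : (inl d : GroupG ℓ ω hω) ∈ subDF ℓ ω hω := by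
  change rightHom (inl d : GroupG ℓ ω hω) ∈ subF ℓ
  rw [SemidirectProduct.rightHom_inl]
  exact one_mem _

theorem inr_mem_subDF {s : GroupE ℓ} (hs : s ∈ ({elemz ℓ, elemg ℓ ^ ℓ, elemh ℓ} : Set _)) :
    (inr s : GroupG ℓ ω hω) ∈ subDF ℓ ω hω := by
  change rightHom (inr s : GroupG ℓ ω hω) ∈ subF ℓ
  rw [SemidirectProduct.rightHom_inr]
  exact Subgroup.subset_closure hs

theorem subZ_le_subDF : subZ ℓ ω hω ≤ subDF ℓ ω hω := by
  rw [subZ, Subgroup.zpowers_le]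
  exact inr_mem_subDF (by simp)

instance : IsMulCommutative (subD ℓ ω hω) :=
  ⟨⟨by
    rintro ⟨_, d, rfl⟩ ⟨_, d', rfl⟩
    exact Subtype.ext (by
      change inl d * inl d' = inl d' * inl d
      rw [← map_mul, mul_comm, map_mul])⟩⟩

theorem lam_elemg_ne_one {lam : GroupG ℓ ω hω →* Kˣ} (hlam : lam ≠ 1)
    (hker : subDF ℓ ω hω ≤ lam.ker) : lam (inr (elemg ℓ)) ≠ 1 := fun h =>
  hlam (MonoidHom.ext fun x => mem_of_generators (S := lam.ker) (fun d => hker (inl_mem_subDF d))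
    (hker (inr_mem_subDF (by simp))) h (hker (inr_mem_subDF (by simp))) x)

theorem apply_elemz_ne_one {φ : subZ ℓ ω hω →* Kˣ} (hφ : φ ≠ 1) :
    φ ⟨inr (elemz ℓ), mem_subZ_elemz⟩ ≠ 1 := fun h => by
  refine hφ (MonoidHom.ext ?_)
  rintro ⟨_, k, rfl⟩
  change φ (⟨inr (elemz ℓ), mem_subZ_elemz⟩ ^ k) = 1
  rw [map_zpow, h, one_zpow]

theorem apply_elemz_pow (φ : subZ ℓ ω hω →* Kˣ) :
    φ ⟨inr (elemz ℓ), mem_subZ_elemz⟩ ^ ℓ = 1 := by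
  rw [← map_pow, ← map_one φ]
  congr 1
  refine Subtype.ext ?_
  change inr (elemz ℓ) ^ ℓ = 1
  rw [← map_pow, elemz_pow_self, map_one]

end Parameters

end PicardBlock

theorem proposition4p3 (p ℓ : ℕ) [Fact p.Prime] [Fact ℓ.Prime] (hℓp : ℓ ≠ p)
    (O K : Type u) [CommRing O] [IsDomain O] [IsDiscreteValuationRing O]
    [IsAdicComplete (IsLocalRing.maximalIdeal O) O]
    [CharP (IsLocalRing.ResidueField O) p] [IsAlgClosed (IsLocalRing.ResidueField O)]
    [Field K] [CharZero K] [Algebra O K] [IsFractionRing O K]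
    (ω : (FieldF ℓ p)ˣ) (hω : IsPrimitiveRoot ω (ℓ ^ 2))
    -- `K` contains all roots of unity of order dividing `|G|`
    (hK : ∃ ζ : K, IsPrimitiveRoot ζ (Nat.card (GroupG ℓ ω hω)))
    (φ : subZ ℓ ω hω →* Kˣ) (hφ : φ ≠ 1) :
    -- `B = O G e_φ` is a block with defect group `D` and abelian inertial quotient
    ∃ hB : IsBlockIdempotent (charIdempotent O (subZ ℓ ω hω) φ),
      IsDefectGroup (charIdempotent O (subZ ℓ ω hω) φ) (subD ℓ ω hω) ∧
      IsMulCommutative (subD ℓ ω hω) ∧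
      HasAbelianInertialQuotient (charIdempotent O (subZ ℓ ω hω) φ) (subD ℓ ω hω) ∧
      ∀ lam : GroupG ℓ ω hω →* Kˣ, lam ≠ 1 → subDF ℓ ω hω ≤ lam.ker →
        -- tensoring with `lam` preserves the category of `B`-modules
        ∃ hfix : tensorChar O lam (charIdempotent O (subZ ℓ ω hω) φ) =
            charIdempotent O (subZ ℓ ω hω) φ,
          (hB.tensorBimod lam hfix).InducesTwist (hB.tensorEnd lam hfix) ∧
          HasVertex (hB.rep (hB.tensorBimod lam hfix)) (diagD ℓ ω hω) ∧
          ∃ x : Pic O hB.Alg, x.val = (hB.tensorBimod lam hfix).cls ∧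
            x ∈ Picent O hB.Alg K ∧ x ≠ 1 := by
  have : CharZero O := (algebraMap O K).charZero
  have hℓ : IsUnit (ℓ : O) := by
    rw [← IsLocalRing.residue_ne_zero_iff_isUnit, map_natCast, Ne, CharP.cast_eq_zero_iff _ p,
      Nat.prime_dvd_prime_iff_eq Fact.out Fact.out]
    exact hℓp.symm
  have hN := isPGroup_ker (hω := hω)
  have hu := isUnit_card_subZ (hω := hω) hℓ
  have hi := isUnit_index_ker (hω := hω) hℓ
  have hZ := subZ_le_center (hω := hω)
  have hC : ∀ x ∈ Subgroup.centralizer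
      ((SemidirectProduct.rightHom : GroupG ℓ ω hω →* GroupE ℓ).ker : Set _),
      SemidirectProduct.rightHom x ∈ (subZ ℓ ω hω).map SemidirectProduct.rightHom :=
    fun x hx => rightHom_mem_of_mem_centralizer hx
  have := hasEnoughRootsOfUnity_exponent hK
  have hB := isBlockIdempotent_charIdempotent (O := O) φ
    (SemidirectProduct.rightHom : GroupG ℓ ω hω →* GroupE ℓ) hN hC hZ hu
  refine ⟨hB, ?_, inferInstance, ?_, fun lam hlam hker => ?_⟩
  · rw [subD_eq_ker]
    exact isDefectGroup_charIdempotent φ _ hN hZ hu hi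
  · rw [subD_eq_ker]
    exact hasAbelianInertialQuotient_charIdempotent φ _ hN hC hZ hu rightHom_commutator_mem
  have hlamD : ∀ d ∈ (SemidirectProduct.rightHom : GroupG ℓ ω hω →* GroupE ℓ).ker, lam d = 1 :=
    fun d hd => by
      rw [← subD_eq_ker] at hd
      obtain ⟨d, rfl⟩ := hd
      exact hker (inl_mem_subDF d)
  have hkerZ : subZ ℓ ω hω ≤ lam.ker := subZ_le_subDF.trans hker
  have hlg : lam (SemidirectProduct.inr (elemg ℓ)) ^ ℓ = 1 := by
    rw [← map_pow, ← map_pow]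
    exact hker (inr_mem_subDF (by simp))
  have hkerZ' : subZ ℓ ω hω ≤ lam⁻¹.ker := fun x hx =>
    inv_eq_one.2 (hkerZ hx)
  have hfix := tensorChar_charIdempotent (O := O) φ hkerZ
  have hfix' := tensorChar_charIdempotent (O := O) φ hkerZ'
  -- Twisting by λ and twisting by λ⁻¹ are mutually inverse, which makes the class of M_λ a unit.
  have h1 := hB.tensorEnd_tensorEnd hfix hfix' fun g => mul_inv_cancel (lam g)
  have h2 := hB.tensorEnd_tensorEnd hfix' hfix fun g => inv_mul_cancel (lam g)
  refine ⟨hfix, inducesTwist_twist _, ?_, twistUnit _ _ h2 h1, rfl, ⟨_, rfl, ?_⟩, fun hone => ?_⟩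
  · rw [diagD, subD_eq_ker]
    exact hB.hasVertex_tensorBimod hfix hlamD hN hi (isUnit_coeff_one_charIdempotent φ hu)
  · refine hB.fixesIrr_tensorBimod hfix (fun a => ⟨_, h1 a⟩) fun V _ _ _ _ _ _ _ hV hirr => ?_
    refine exists_intertwiner Fact.out
      (ζ := (φ ⟨SemidirectProduct.inr (elemz ℓ), mem_subZ_elemz⟩ : K)) ?_ ?_ hirr (fun v => ?_)
      (fun d => hker (inl_mem_subDF d)) (hker (inr_mem_subDF (by simp)))
      (hker (inr_mem_subDF (by simp))) hlg
    · rw [← Units.val_pow_eq_pow_val, apply_elemz_pow, Units.val_one]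
    · rw [Ne, Units.val_eq_one]
      exact apply_elemz_ne_one hφ
    · rw [hB.moduleRep_central V (single_mul_charIdempotent φ
        (⟨SemidirectProduct.inr (elemz ℓ), mem_subZ_elemz⟩ : subZ ℓ ω hω)), algebraMap_integralChar]
  · refine hB.not_tensorBimod_isIso_regular _ hN hC hfix hlamD
      (g := SemidirectProduct.inr (elemg ℓ)) (fun h => lam_elemg_ne_one hlam hker ?_)
      (Quotient.exact (congrArg Units.val hone))
    -- As λ(g)^ℓ = 1 and ℓ is a unit of O, congruence to 1 would give λ(g) = 1, whereas λ is
    -- nontrivial and g is the only generator outside D ⋊ F.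
    have h3 : (integralChar O lam (SemidirectProduct.inr (elemg ℓ)) : O) = 1 := by
      refine eq_one_of_residue_eq_one (n := ℓ) ?_ hℓ h
      rw [← Units.val_pow_eq_pow_val, ← map_pow]
      rw [integralChar_eq_one (by rw [map_pow, hlg]), Units.val_one]
    refine Units.ext ?_
    rw [← algebraMap_integralChar O, h3, map_one, Units.val_one]
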